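/- Let $n\ge 0$ and $S_0=\{i\in\mathbb Z^n: i_1,\dots,i_n\ge 0\}$, and let $\epsilon_k$ be the $k$-th unit vector of $\mathbb Z^n$. Let $(a_i)_{i\in S_0}$ be nonnegative real numbers with $a_0=1$ and $a_{i+j}\le a_ia_j$ for all $i,j\in S_0$. For $i\in\mathbb Z^n$ let $$A_i=\{m\in S_0: m+i\in S_0\text{ and } a_m,a_{m+i}\text{ are not both }0\},$$ and let $C_i=\sup_{m\in A_i}\frac{a_{m+i}}{a_m}\in[0,\infty]$ if $A_i\ne\emptyset$ (a positive number divided by $0$ being $\infty$), and $C_i=\infty$ otherwise. Let $S=\{k: C_{-\epsilon_k}<\infty\}$, $M=\{i\in\mathbb Z^n: i_k\ge 0\text{ for all }k\notin S\}$, and $$K=\{s\in\mathbb C^n: |s_1^{i_1}\cdots s_n^{i_n}|\le C_i\text{ for all }i\in M\},$$ where the inequality is understood to include that the monomial is defined at $s$, that is, $s_k\neq0$ whenever $i_k<0$. A set $E\subset\mathbb C^n$ is called *circled* if $(\alpha_1s_1,\dots,\alpha_ns_n)\in E$ whenever $s\in E$ and $|\alpha_1|=\dots=|\alpha_n|=1$.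 It is called *rationally convex* if it is compact and contains every $s\in\mathbb C^n$ such that $|f(s)|\le\sup_E|f|$ for all quotients $f=p/q$ of polynomials with $q$ zero-free on $E$ (where $|f(s)|\le\sup_E|f|$ includes that $q(s)\ne0$). Connected sets are nonempty. The *joint spectrum* of elements $x_1,\dots,x_n$ of a commutative (unital, complex) Banach algebra $A$ is $\sigma(x_1,\dots,x_n)=\{(\phi(x_1),\dots,\phi(x_n)):\phi\text{ a nonzero multiplicative linear functional on }A\}$. Then: 1. $K$ is a rationally convex connected circled set. 2. Whenever $x_1,\dots,x_n$ are elements of a commutative Banach algebra with $\|x_1^{i_1}\cdots x_n^{i_n}\|=a_i$ for all $i\in S_0$, there is a smallest rationally convex connected circled subset of $\mathbb C^n$ containing $\sigma(x_1,\dots,x_n)$, and it contains $K$. Furthermore, $K$ is the largest subset of $\mathbb C^n$ for which 2 holds: if 2 holds with $K$ replaced by a set $L\subset\mathbb C^n$, then $L\subset K$. -/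

import Mathlib

open scoped NNReal ENNReal

universe u

namespace JointSpec

noncomputable section

/-! ### Sets in complex `n`-space -/

/-- The rational hull of `K`: all `s` with `|f(s)| ≤ sup_K |f|` for every rational function
`f = p / q`, `p` and `q` polynomials and `q` without zeros on `K`. If `q(s) = 0` for such a `q`,
then `1 / q` is analytic on `K` and infinite at `s`, so `s` is not in the hull; the condition
`q(s) ≠ 0` says this explicitly. (The real supremum is meant for compact `K`, where the functions
are bounded; over the empty set it is `0`.) -/
def rationalHull {n : ℕ} (K : Set (Fin n → ℂ)) : Set (Fin n → ℂ) :=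
  {s | ∀ p q : MvPolynomial (Fin n) ℂ, (∀ z ∈ K, MvPolynomial.eval z q ≠ 0) →
    MvPolynomial.eval s q ≠ 0 ∧
    ‖MvPolynomial.eval s p / MvPolynomial.eval s q‖ ≤
      ⨆ z : K, ‖MvPolynomial.eval (z : Fin n → ℂ) p / MvPolynomial.eval (z : Fin n → ℂ) q‖}

/-- A rationally convex set: compact and equal to its rational hull. -/
def IsRationallyConvex {n : ℕ} (K : Set (Fin n → ℂ)) : Prop :=
  IsCompact K ∧ rationalHull K = K

/-- A circled set: closed under multiplying each coordinate by its own number of modulus `1`. -/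
def IsCircled {n : ℕ} (K : Set (Fin n → ℂ)) : Prop :=
  ∀ s ∈ K, ∀ α : Fin n → ℂ, (∀ k, ‖α k‖ = 1) → (fun k => α k * s k) ∈ K

/-- Rationally convex, connected, circled. -/
def IsRCC {n : ℕ} (K : Set (Fin n → ℂ)) : Prop :=
  IsRationallyConvex K ∧ IsConnected K ∧ IsCircled K

/-! ### The joint spectrum -/

/-- The joint spectrum of `x₁, …, xₙ`: all `(φ(x₁), …, φ(xₙ))`, `φ` a nonzero multiplicative linear
functional, that is, a unital algebra homomorphism to `ℂ`. -/
def jointSpectrum {n : ℕ} {A : Type*} [NormedCommRing A] [NormedAlgebra ℂ A] (x : Fin n → A) :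
    Set (Fin n → ℂ) :=
  Set.range fun (φ : A →ₐ[ℂ] ℂ) (k : Fin n) => φ (x k)

/-! ### The numbers `C_i` and the set `K` of a family `(a_i)`, `i` a nonnegative multi-index -/

/-- All pairs `(m, m + i)` of nonnegative multi-indices such that `a_m` and `a_{m+i}` are not
both `0`. -/
def shiftPairs {n : ℕ} (a : (Fin n → ℕ) → ℝ≥0) (i : Fin n → ℤ) :
    Set ((Fin n → ℕ) × (Fin n → ℕ)) :=
  {p | (∀ k, (p.2 k : ℤ) = (p.1 k : ℤ) + i k) ∧ ¬ (a p.1 = 0 ∧ a p.2 = 0)}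

open Classical in
/-- `C_i`, the supremum of `a_{m+i} / a_m` over the admissible `m`, where a positive number divided
by `0` is `∞`; it is `∞` if there is no admissible `m`. -/
def ratioSup {n : ℕ} (a : (Fin n → ℕ) → ℝ≥0) (i : Fin n → ℤ) : ℝ≥0∞ :=
  if (shiftPairs a i).Nonempty then ⨆ p ∈ shiftPairs a i, (a p.2 : ℝ≥0∞) / (a p.1 : ℝ≥0∞) else ∞

/-- The set `S` of all `k` with `C_{-ε_k}` finite, `ε_k` the `k`-th unit vector. -/
def finiteDirs {n : ℕ} (a : (Fin n → ℕ) → ℝ≥0) : Set (Fin n) :=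
  {k | ratioSup a (-Pi.single k 1) < ∞}

/-- The set `M` of all integer multi-indices that are nonnegative in the coordinates outside `S`. -/
def admissibleExps {n : ℕ} (a : (Fin n → ℕ) → ℝ≥0) : Set (Fin n → ℤ) :=
  {i | ∀ k, k ∉ finiteDirs a → 0 ≤ i k}

/-- The set `K` of all `s` with `|s₁^{i₁} ⋯ sₙ^{iₙ}| ≤ C_i` for all `i ∈ M`; this includes that the
monomial is defined at `s`: `s_k ≠ 0` if `i_k < 0`. -/
def monomialSet {n : ℕ} (a : (Fin n → ℕ) → ℝ≥0) : Set (Fin n → ℂ) :=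
  {s | ∀ i ∈ admissibleExps a, (∀ k, i k < 0 → s k ≠ 0) ∧ ‖∏ k, s k ^ i k‖ₑ ≤ ratioSup a i}

/-- The property of a set `L` that, for all `x₁, …, xₙ` in a commutative complex Banach algebra with
`‖x₁^{i₁} ⋯ xₙ^{iₙ}‖ = a_i` for all `i`, there is a smallest rationally convex connected circled set
containing the joint spectrum, and it contains `L`. -/
def ForcedInHull {n : ℕ} (a : (Fin n → ℕ) → ℝ≥0) (L : Set (Fin n → ℂ)) : Prop :=
  ∀ (A : Type u) [NormedCommRing A] [NormedAlgebra ℂ A] [CompleteSpace A] (x : Fin n → A),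
    (∀ i : Fin n → ℕ, ‖∏ k, x k ^ i k‖ = a i) →
    ∃ E : Set (Fin n → ℂ),
      IsLeast {E' : Set (Fin n → ℂ) | IsRCC E' ∧ jointSpectrum x ⊆ E'} E ∧ L ⊆ E

end

end JointSpec

/-! Rationally convex connected circled sets are exactly the nonempty compact sets cut out by bounds
on Laurent monomials. One direction is elementary: a Laurent monomial is a quotient of polynomials,
and moduli can be interpolated geometrically (`isRCC_boundedSet`). For the other
(`IsRCC.eq_boundedSet`), a polynomial q without zeros on such a set E has, around each torus in E, a
reciprocal Laurent series, absolutely convergent by Gelfand theory in a weighted ℓ¹ algebra.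
Uniqueness and connectedness make it one series for all of E. Monomial bounds carry its convergence
to each point s of the monomial hull, so q(s) ≠ 0; applied to p - l q, this bounds p/q as well.
Hence nonempty intersections of such sets are again of this kind, and a least one around the
spectrum exists.

K lies in every such E around the spectrum (`monomialSet_subset_of_isRCC`): if the monomial with
exponent i is defined on E, then x_k is invertible whenever i_k < 0, so i ∈ M and y = x^i exists.
For s in K, |s^i|^N ≤ C_{Ni} ≤ ‖y^N‖, and the spectral radius formula bounds |s^i| by any bound for
the monomial on the spectrum.

K is largest (`subset_monomialSet`): for each i ∈ M there is a submultiplicative weight on M that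
extends a and is at most C_i at i (`extensionNorms`). Its weighted algebra realizes a, and the
spectrum obeys the i-th bound, so L does too. K is nonempty because another weight on M, lying below
C (`eventualBounds`), yields an algebra whose spectrum lies in K. -/

namespace JointSpec

/-! ### Weighted ℓ¹ algebras of commutative monoids -/

section WeightedAlgebra

variable {M : Type}

/-- The weighted `ℓ¹` sum of the coefficients. -/
noncomputable def weightedSum (w : M → ℝ≥0) (f : AddMonoidAlgebra ℂ M) : ℝ :=
  f.coeff.sum fun i c => ‖c‖ * w i

lemma weightedSum_eq_sum (w : M → ℝ≥0) (f : AddMonoidAlgebra ℂ M) (T : Finset M)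
    (hT : f.coeff.support ⊆ T) : weightedSum w f = ∑ i ∈ T, ‖f.coeff i‖ * w i :=
  Finsupp.sum_of_support_subset _ hT _ (by simp)

lemma weightedSum_single (w : M → ℝ≥0) (i : M) (c : ℂ) :
    weightedSum w (AddMonoidAlgebra.single i c) = ‖c‖ * w i := by
  simp [weightedSum]

lemma weightedSum_zero (w : M → ℝ≥0) : weightedSum w 0 = 0 := by
  simp [weightedSum]

lemma weightedSum_add_le (w : M → ℝ≥0) (f g : AddMonoidAlgebra ℂ M) :
    weightedSum w (f + g) ≤ weightedSum w f + weightedSum w g := by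
  classical
  rw [weightedSum_eq_sum w f (f.coeff.support ∪ g.coeff.support) Finset.subset_union_left,
    weightedSum_eq_sum w g (f.coeff.support ∪ g.coeff.support) Finset.subset_union_right,
    weightedSum_eq_sum w (f + g) (f.coeff.support ∪ g.coeff.support)
      (by rw [AddMonoidAlgebra.coeff_add]; exact Finsupp.support_add),
    ← Finset.sum_add_distrib]
  refine Finset.sum_le_sum fun i _ => ?_
  rw [← add_mul, AddMonoidAlgebra.coeff_add]
  exact mul_le_mul_of_nonneg_right (norm_add_le _ _) (w i).2

lemma weightedSum_sum_le {ι : Type*} (w : M → ℝ≥0) (s : Finset ι)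
    (f : ι → AddMonoidAlgebra ℂ M) :
    weightedSum w (∑ i ∈ s, f i) ≤ ∑ i ∈ s, weightedSum w (f i) :=
  Finset.le_sum_of_subadditive _ (weightedSum_zero w).le (weightedSum_add_le w) _ _

lemma weightedSum_mul_le [AddCommMonoid M] (w : M → ℝ≥0) (hw : ∀ i j, w (i + j) ≤ w i * w j)
    (f g : AddMonoidAlgebra ℂ M) :
    weightedSum w (f * g) ≤ weightedSum w f * weightedSum w g := by
  rw [AddMonoidAlgebra.mul_def]
  refine (weightedSum_sum_le w _ _).trans ?_
  rw [weightedSum, weightedSum, Finsupp.sum, Finset.sum_mul]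
  refine Finset.sum_le_sum fun i _ => (weightedSum_sum_le w _ _).trans ?_
  rw [Finsupp.sum, Finset.mul_sum]
  refine Finset.sum_le_sum fun j _ => ?_
  rw [weightedSum_single, norm_mul]
  calc ‖f.coeff i‖ * ‖g.coeff j‖ * w (i + j) ≤ ‖f.coeff i‖ * ‖g.coeff j‖ * (w i * w j) := by
        gcongr; exact_mod_cast hw i j
    _ = _ := by ring

/-- The weighted `ℓ¹` seminorm attached to a submultiplicative weight. -/
noncomputable def weightedSeminorm [AddCommMonoid M] (w : M → ℝ≥0) (hw : ∀ i j, w (i + j) ≤ w i * w j) :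
    RingSeminorm (AddMonoidAlgebra ℂ M) where
  toFun := weightedSum w
  map_zero' := weightedSum_zero w
  add_le' := weightedSum_add_le w
  neg' f := by simp [weightedSum, Finsupp.sum]
  mul_le' := weightedSum_mul_le w hw

/-- A submultiplicative weight `w` on a commutative monoid with `w 0 = 1` is realized by the norms
of the monomials in a commutative Banach algebra; for positive weights the elements of the algebra
have coefficients, absolutely summable with respect to the weight. -/
theorem exists_weighted_algebra [AddCommMonoid M] (w : M → ℝ≥0) (hw0 : w 0 = 1)
    (hw : ∀ i j, w (i + j) ≤ w i * w j) :
    ∃ (A : Type) (_ : NormedCommRing A) (_ : NormedAlgebra ℂ A) (_ : CompleteSpace A)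
      (X : Multiplicative M →* A), (∀ i, ‖X (Multiplicative.ofAdd i)‖ = w i) ∧ ‖(1 : A)‖ = 1 ∧
      ((∀ i, 0 < w i) → ∃ c : A →ₗ[ℂ] (M → ℂ),
        (∀ a (T : Finset M), ∑ i ∈ T, ‖c a i‖ * w i ≤ ‖a‖) ∧
        (∀ i, c 1 i = AddMonoidAlgebra.coeff 1 i) ∧
        (∀ a i j, (∀ k, i + k = i + j → k = j) →
          c (X (Multiplicative.ofAdd i) * a) (i + j) = c a j) ∧
        (∀ a i j, (∀ k, i + k ≠ j) → c (X (Multiplicative.ofAdd i) * a) j = 0)) := by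
  let B := AddMonoidAlgebra ℂ M
  -- Weights may vanish, so this is only a seminorm; the completion identifies the monomials of
  -- weight zero with zero.
  let _ : SeminormedCommRing B :=
    { (weightedSeminorm w hw).toSeminormedRing with
      mul_comm := mul_comm }
  let _ : NormedAlgebra ℂ B :=
    { (inferInstance : Algebra ℂ (AddMonoidAlgebra ℂ M)) with
      norm_smul_le := fun r f => by
        change weightedSum w (r • f) ≤ ‖r‖ * weightedSum w f
        rw [weightedSum_eq_sum w (r • f) f.coeff.support (by
          rw [AddMonoidAlgebra.coeff_smul]; exact Finsupp.support_smul),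
          weightedSum, Finsupp.sum, Finset.mul_sum]
        refine Finset.sum_le_sum fun i _ => ?_
        rw [AddMonoidAlgebra.coeff_smul_apply, norm_smul, mul_assoc] }
  have hnorm : ∀ f : B, ‖f‖ = weightedSum w f := fun f => rfl
  let X : Multiplicative M →* UniformSpace.Completion B :=
    (UniformSpace.Completion.coeRingHom (α := B)).toMonoidHom.comp (AddMonoidAlgebra.of ℂ M)
  have hX : ∀ i, X (Multiplicative.ofAdd i) =
      ((AddMonoidAlgebra.single i 1 : B) : UniformSpace.Completion B) := fun i => rfl
  have hXn : ∀ i, ‖X (Multiplicative.ofAdd i)‖ = w i := fun i => by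
    rw [hX, UniformSpace.Completion.norm_coe, hnorm, weightedSum_single]; simp
  refine ⟨UniformSpace.Completion B, inferInstance, inferInstance, inferInstance, X, hXn, ?_, ?_⟩
  · have := hXn 0
    rwa [ofAdd_zero, map_one, hw0, NNReal.coe_one] at this
  intro hpos
  have hle : ∀ (f : B) (T : Finset M), ∑ i ∈ T, ‖f.coeff i‖ * w i ≤ ‖f‖ := fun f T => by
    classical
    rw [hnorm, weightedSum_eq_sum w f (f.coeff.support ∪ T) Finset.subset_union_left]
    exact Finset.sum_le_sum_of_subset_of_nonneg Finset.subset_union_right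
      fun i _ _ => by positivity
  -- For positive w i the coefficient functional is continuous with constant 1 / w i, hence extends
  -- to the completion; all coefficient identities then pass to limits.
  let c₀ : M → (B →L[ℂ] ℂ) := fun i => LinearMap.mkContinuous
    { toFun := fun f => f.coeff i
      map_add' := fun f g => rfl
      map_smul' := fun r f => rfl } (w i : ℝ)⁻¹ (fun f => by
        have h1 := hle f {i}
        rw [Finset.sum_singleton] at h1
        rw [inv_mul_eq_div, le_div_iff₀ (by exact_mod_cast hpos i)]
        exact h1)
  have hc₀ : ∀ i f, c₀ i f = f.coeff i := fun _ _ => rfl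
  let c : M → (UniformSpace.Completion B →L[ℂ] ℂ) := fun i =>
    (c₀ i).extend (UniformSpace.Completion.toComplL (𝕜 := ℂ) (E := B))
  have hc : ∀ i (f : B), c i (f : UniformSpace.Completion B) = f.coeff i := fun i f =>
    ContinuousLinearMap.extend_eq (c₀ i) (e := UniformSpace.Completion.toComplL (𝕜 := ℂ) (E := B))
      UniformSpace.Completion.denseRange_coe (UniformSpace.Completion.isUniformInducing_coe B) f
  refine ⟨LinearMap.pi fun i => (c i).toLinearMap, ?_, ?_, ?_, ?_⟩
  · intro a T
    change ∑ i ∈ T, ‖c i a‖ * w i ≤ ‖a‖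
    induction a using UniformSpace.Completion.induction_on with
    | hp => exact isClosed_le (by fun_prop) (by fun_prop)
    | ih f => simpa only [hc, UniformSpace.Completion.norm_coe] using hle f T
  · intro i
    exact hc i 1
  · intro a i j hij
    change c (i + j) (X _ * a) = c j a
    induction a using UniformSpace.Completion.induction_on with
    | hp => exact isClosed_eq (by fun_prop) (by fun_prop)
    | ih f =>
      rw [hX, ← UniformSpace.Completion.coe_mul, hc, hc,
        AddMonoidAlgebra.coeff_single_mul_eq_mul_coeff j fun k _ => ⟨hij k, fun h => by rw [h]⟩,
        one_mul]
  · intro a i j hij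
    change c j (X _ * a) = 0
    induction a using UniformSpace.Completion.induction_on with
    | hp => exact isClosed_eq (by fun_prop) (by fun_prop)
    | ih f =>
      rw [hX, ← UniformSpace.Completion.coe_mul, hc,
        AddMonoidAlgebra.coeff_single_mul_of_forall_add_ne 1 f hij]

end WeightedAlgebra

/-! ### Sets given by bounds on Laurent monomials -/

section MonomialBounds

variable {n : ℕ}

/-- The points at which the monomials in `F` are defined and satisfy the bounds in `F`. -/
def boundedSet (F : Set ((Fin n → ℤ) × ℝ)) : Set (Fin n → ℂ) :=
  {s | ∀ p ∈ F, (∀ k, p.1 k < 0 → s k ≠ 0) ∧ ‖∏ k, s k ^ p.1 k‖ ≤ p.2}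

/-- The numerator of a monomial with integer exponents. -/
noncomputable def monomialNum (i : Fin n → ℤ) : MvPolynomial (Fin n) ℂ :=
  ∏ k, MvPolynomial.X k ^ (i k).toNat

lemma eval_monomialNum (i : Fin n → ℤ) (s : Fin n → ℂ) :
    MvPolynomial.eval s (monomialNum i) = ∏ k, s k ^ (i k).toNat := by
  simp [monomialNum]

lemma eval_monomialNum_neg_ne_zero {i : Fin n → ℤ} {s : Fin n → ℂ}
    (h : ∀ k, i k < 0 → s k ≠ 0) : MvPolynomial.eval s (monomialNum (-i)) ≠ 0 := by
  rw [eval_monomialNum, Finset.prod_ne_zero_iff]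
  intro k _
  by_cases hk : i k < 0
  · exact pow_ne_zero _ (h k hk)
  · rw [Pi.neg_apply, Int.toNat_of_nonpos (by omega), pow_zero]
    exact one_ne_zero

lemma eval_monomialNum_div (i : Fin n → ℤ) (s : Fin n → ℂ) :
    MvPolynomial.eval s (monomialNum i) / MvPolynomial.eval s (monomialNum (-i)) =
      ∏ k, s k ^ i k := by
  rw [eval_monomialNum, eval_monomialNum, ← Finset.prod_div_distrib]
  refine Finset.prod_congr rfl fun k _ => ?_
  rw [Pi.neg_apply]
  rcases le_total 0 (i k) with h | h
  · rw [Int.toNat_of_nonpos (z := -i k) (by omega), pow_zero, div_one, ← zpow_natCast,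
      Int.toNat_of_nonneg h]
  · rw [Int.toNat_of_nonpos h, pow_zero, ← zpow_natCast, Int.toNat_of_nonneg (by omega),
      zpow_neg, one_div, inv_inv]

lemma continuous_eval (p : MvPolynomial (Fin n) ℂ) :
    Continuous fun s : Fin n → ℂ => MvPolynomial.eval s p := p.continuous_eval

lemma bddAbove_norm_eval_div {E : Set (Fin n → ℂ)} (hE : IsCompact E)
    (p q : MvPolynomial (Fin n) ℂ) (hq : ∀ z ∈ E, MvPolynomial.eval z q ≠ 0) :
    BddAbove (Set.range fun z : E =>
      ‖MvPolynomial.eval (z : Fin n → ℂ) p / MvPolynomial.eval (z : Fin n → ℂ) q‖) := by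
  have := hE.bddAbove_image (f := fun z => ‖MvPolynomial.eval z p / MvPolynomial.eval z q‖)
    (((continuous_eval p).continuousOn.div (continuous_eval q).continuousOn hq).norm)
  rwa [Set.image_eq_range] at this

lemma subset_rationalHull {E : Set (Fin n → ℂ)} (hE : IsCompact E) : E ⊆ rationalHull E :=
  fun s hs p q hq => ⟨hq s hs, le_ciSup (bddAbove_norm_eval_div hE p q hq) ⟨s, hs⟩⟩

/-- The defining bounds are themselves bounds on admissible quotients of polynomials. Definedness at
a hull point comes from taking a coordinate as denominator. -/
lemma isRationallyConvex_boundedSet {F : Set ((Fin n → ℤ) × ℝ)} (hne : (boundedSet F).Nonempty)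
    (hcpt : IsCompact (boundedSet F)) : IsRationallyConvex (boundedSet F) := by
  refine ⟨hcpt, Set.Subset.antisymm ?_ (subset_rationalHull hcpt)⟩
  intro s hs p hp
  have hdef : ∀ z ∈ boundedSet F, MvPolynomial.eval z (monomialNum (-p.1)) ≠ 0 :=
    fun z hz => eval_monomialNum_neg_ne_zero (hz p hp).1
  obtain ⟨-, h2⟩ := hs (monomialNum p.1) (monomialNum (-p.1)) hdef
  constructor
  · intro k hk
    have := (hs 0 (MvPolynomial.X k) fun z hz => by
      rw [MvPolynomial.eval_X]; exact (hz p hp).1 k hk).1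
    rwa [MvPolynomial.eval_X] at this
  · rw [← eval_monomialNum_div]
    have := hne.to_subtype
    refine h2.trans (ciSup_le fun z => ?_)
    rw [eval_monomialNum_div]
    exact (z.2 p hp).2

lemma isCircled_boundedSet (F : Set ((Fin n → ℤ) × ℝ)) : IsCircled (boundedSet F) := by
  intro s hs α hα p hp
  refine ⟨fun k hk => mul_ne_zero (fun h => by simpa [h] using hα k) ((hs p hp).1 k hk), ?_⟩
  simpa [mul_zpow, Finset.prod_mul_distrib, norm_prod, hα] using (hs p hp).2

/-- Shrinking a coordinate can only increase monomials in which its exponent is negative; such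
coordinates keep their modulus. -/
lemma mem_boundedSet_of_norm_le {F : Set ((Fin n → ℤ) × ℝ)} {s t : Fin n → ℂ}
    (hs : s ∈ boundedSet F) (hle : ∀ k, ‖t k‖ ≤ ‖s k‖)
    (heq : ∀ k, (∃ p ∈ F, p.1 k < 0) → ‖t k‖ = ‖s k‖) : t ∈ boundedSet F := by
  intro p hp
  refine ⟨fun k hk => ?_, ?_⟩
  · rw [← norm_ne_zero_iff, heq k ⟨p, hp, hk⟩, norm_ne_zero_iff]
    exact (hs p hp).1 k hk
  · refine le_trans ?_ (hs p hp).2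
    rw [norm_prod, norm_prod]
    refine Finset.prod_le_prod (fun k _ => norm_nonneg _) fun k _ => ?_
    rw [norm_zpow, norm_zpow]
    rcases lt_or_ge (p.1 k) 0 with h | h
    · rw [heq k ⟨p, hp, h⟩]
    · exact zpow_le_zpow_left₀ h (norm_nonneg _) (hle k)

/-- The point with the same moduli in the coordinates in `N` and zeros elsewhere. -/
noncomputable def modulusPoint (N : Set (Fin n)) [DecidablePred (· ∈ N)] (s : Fin n → ℂ) :
    Fin n → ℂ :=
  fun k => if k ∈ N then (‖s k‖ : ℂ) else 0

/-- Coordinates in N never vanish and are rotated to the positive axis; the others are shrunk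
radially to zero. -/
lemma joinedIn_modulusPoint {F : Set ((Fin n → ℤ) × ℝ)} (N : Set (Fin n))
    [DecidablePred (· ∈ N)] (hN : ∀ k, k ∈ N ↔ ∃ p ∈ F, p.1 k < 0) {s : Fin n → ℂ}
    (hs : s ∈ boundedSet F) : JoinedIn (boundedSet F) s (modulusPoint N s) := by
  let γ : ℝ → Fin n → ℂ := fun t k =>
    if k ∈ N then s k * Complex.exp (-(t * Complex.arg (s k)) * Complex.I) else (1 - t) * s k
  refine JoinedIn.ofLine (f := γ) ?_ ?_ ?_ ?_
  · refine (continuous_pi fun k => ?_).continuousOn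
    by_cases hk : k ∈ N <;> simp only [γ, hk, if_true, if_false] <;> fun_prop
  · funext k
    by_cases hk : k ∈ N <;> simp [γ, hk]
  · funext k
    by_cases hk : k ∈ N
    · simp only [γ, modulusPoint, hk, if_true]
      nth_rewrite 1 [← Complex.norm_mul_exp_arg_mul_I (s k)]
      rw [mul_assoc, ← Complex.exp_add]
      simp
    · simp [γ, modulusPoint, hk]
  · rintro _ ⟨t, ht, rfl⟩
    have hexp : ∀ k, ‖Complex.exp (-(t * Complex.arg (s k)) * Complex.I)‖ = 1 := fun k => by
      have := Complex.norm_exp_ofReal_mul_I (-(t * Complex.arg (s k)))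
      push_cast at this
      exact this
    refine mem_boundedSet_of_norm_le hs (fun k => ?_) fun k hk => ?_
    · by_cases hk : k ∈ N
      · simp only [γ, hk, if_true, norm_mul, hexp, mul_one, le_refl]
      · simp only [γ, hk, if_false, norm_mul]
        refine mul_le_of_le_one_left (norm_nonneg _) ?_
        rw [← Complex.ofReal_one, ← Complex.ofReal_sub, Complex.norm_real, Real.norm_eq_abs,
          abs_le]
        constructor <;> linarith [ht.1, ht.2]
    · simp only [γ, (hN k).2 hk, if_true, norm_mul, hexp, mul_one]

/-- Sets given by monomial bounds are logarithmically convex: along the geometric interpolation of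
the moduli, each monomial is the weighted geometric mean of its end values. -/
lemma joinedIn_modulusPoint_modulusPoint {F : Set ((Fin n → ℤ) × ℝ)} (N : Set (Fin n))
    [DecidablePred (· ∈ N)] (hN : ∀ k, k ∈ N ↔ ∃ p ∈ F, p.1 k < 0) {s t : Fin n → ℂ}
    (hs : s ∈ boundedSet F) (ht : t ∈ boundedSet F) :
    JoinedIn (boundedSet F) (modulusPoint N s) (modulusPoint N t) := by
  have hs0 : ∀ k ∈ N, 0 < ‖s k‖ := fun k hk => by
    obtain ⟨p, hp, h⟩ := (hN k).1 hk
    exact norm_pos_iff.2 ((hs p hp).1 k h)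
  have ht0 : ∀ k ∈ N, 0 < ‖t k‖ := fun k hk => by
    obtain ⟨p, hp, h⟩ := (hN k).1 hk
    exact norm_pos_iff.2 ((ht p hp).1 k h)
  let γ : ℝ → Fin n → ℂ := fun τ k =>
    if k ∈ N then ((‖s k‖ ^ (1 - τ) * ‖t k‖ ^ τ : ℝ) : ℂ) else 0
  have hms := (joinedIn_modulusPoint N hN hs).target_mem
  have hmt := (joinedIn_modulusPoint N hN ht).target_mem
  refine JoinedIn.ofLine (f := γ) ?_ ?_ ?_ ?_
  · refine (continuous_pi fun k => ?_).continuousOn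
    by_cases hk : k ∈ N
    · simp only [γ, hk, if_true]
      refine Complex.continuous_ofReal.comp (Continuous.mul ?_ ?_)
      · exact Continuous.rpow continuous_const (by fun_prop) fun _ => Or.inl (hs0 k hk).ne'
      · exact Continuous.rpow continuous_const (by fun_prop) fun _ => Or.inl (ht0 k hk).ne'
    · simp only [γ, hk, if_false]; fun_prop
  · funext k
    by_cases hk : k ∈ N <;> simp [γ, modulusPoint, hk]
  · funext k
    by_cases hk : k ∈ N <;> simp [γ, modulusPoint, hk]
  · rintro _ ⟨τ, hτ, rfl⟩ p hp
    refine ⟨fun k hk => ?_, ?_⟩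
    · have hkN : k ∈ N := (hN k).2 ⟨p, hp, hk⟩
      simp only [γ, hkN, if_true]
      exact Complex.ofReal_ne_zero.2 (mul_pos (Real.rpow_pos_of_pos (hs0 k hkN) _)
        (Real.rpow_pos_of_pos (ht0 k hkN) _)).ne'
    · have h1 := (hms p hp).2
      have h2 := (hmt p hp).2
      have key : ∀ k, ‖γ τ k ^ p.1 k‖ =
          ‖modulusPoint N s k ^ p.1 k‖ ^ (1 - τ) * ‖modulusPoint N t k ^ p.1 k‖ ^ τ := by
        intro k
        by_cases hk : k ∈ N
        · simp only [γ, modulusPoint, hk, if_true, norm_zpow, Complex.norm_real, norm_mul,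
            Real.norm_eq_abs, abs_norm,
            abs_of_pos (Real.rpow_pos_of_pos (hs0 k hk) _),
            abs_of_pos (Real.rpow_pos_of_pos (ht0 k hk) _), mul_zpow]
          congr 1
          · rw [← Real.rpow_intCast, ← Real.rpow_mul (norm_nonneg _), mul_comm,
              Real.rpow_mul (norm_nonneg _), Real.rpow_intCast]
          · rw [← Real.rpow_intCast, ← Real.rpow_mul (norm_nonneg _), mul_comm,
              Real.rpow_mul (norm_nonneg _), Real.rpow_intCast]
        · simp only [γ, modulusPoint, hk, if_false, norm_zpow, norm_zero]
          -- The base may be zero; the addition law for exponents still holds because they sum to 1.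
          rw [← Real.rpow_add' (by positivity) (by simp)]
          simp
      have hB : 0 ≤ p.2 := (norm_nonneg _).trans h1
      rw [norm_prod, Finset.prod_congr rfl fun k _ => key k, Finset.prod_mul_distrib,
        Real.finsetProd_rpow _ _ (fun k _ => norm_nonneg _),
        Real.finsetProd_rpow _ _ (fun k _ => norm_nonneg _), ← norm_prod, ← norm_prod]
      calc _ ≤ p.2 ^ (1 - τ) * p.2 ^ τ := by
            gcongr
            · linarith [hτ.2]
            · exact hτ.1
        _ = p.2 := by rw [← Real.rpow_add' hB (by simp)]; simp

lemma isConnected_boundedSet {F : Set ((Fin n → ℤ) × ℝ)} (hne : (boundedSet F).Nonempty) :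
    IsConnected (boundedSet F) := by
  classical
  let N : Set (Fin n) := {k | ∃ p ∈ F, p.1 k < 0}
  have hN : ∀ k, k ∈ N ↔ ∃ p ∈ F, p.1 k < 0 := fun k => Iff.rfl
  obtain ⟨s, hs⟩ := hne
  refine IsPathConnected.isConnected ⟨s, hs, fun {t} ht => ?_⟩
  exact (joinedIn_modulusPoint N hN hs).trans
    ((joinedIn_modulusPoint_modulusPoint N hN hs ht).trans (joinedIn_modulusPoint N hN ht).symm)

lemma isRCC_boundedSet {F : Set ((Fin n → ℤ) × ℝ)} (hne : (boundedSet F).Nonempty)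
    (hcpt : IsCompact (boundedSet F)) : IsRCC (boundedSet F) :=
  ⟨isRationallyConvex_boundedSet hne hcpt, isConnected_boundedSet hne, isCircled_boundedSet F⟩

lemma prod_zpow_single (s : Fin n → ℂ) (k : Fin n) (z : ℤ) :
    ∏ l, s l ^ (Pi.single k z : Fin n → ℤ) l = s k ^ z := by
  rw [Finset.prod_eq_single k]
  · simp
  · intro l _ hl
    simp [Pi.single_eq_of_ne hl]
  · simp

/-- A bound on the inverse of a coordinate keeps it away from zero, so limit points stay in the
domain of the monomials and the set is closed. -/
lemma isCompact_boundedSet {F : Set ((Fin n → ℤ) × ℝ)}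
    (hup : ∀ k, ∃ B, (Pi.single k 1, B) ∈ F)
    (hdown : ∀ p ∈ F, ∀ k, p.1 k < 0 → ∃ B, (-Pi.single k 1, B) ∈ F) :
    IsCompact (boundedSet F) := by
  choose R hR using hup
  refine Metric.isCompact_of_isClosed_isBounded ?_ ?_
  · have hlow : ∀ p ∈ F, ∀ k, p.1 k < 0 → ∃ c : ℝ, 0 < c ∧ ∀ s ∈ boundedSet F, c ≤ ‖s k‖ := by
      intro p hp k hk
      obtain ⟨B, hB⟩ := hdown p hp k hk
      refine ⟨(|B| + 1)⁻¹, by positivity, fun s hs => ?_⟩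
      have h1 := hs _ hB
      have h0 : 0 < ‖s k‖ := norm_pos_iff.2 (h1.1 k (by simp))
      have h2 := h1.2
      simp only [← Pi.single_neg, prod_zpow_single, zpow_neg, zpow_one, norm_inv] at h2
      rw [inv_le_comm₀ (by positivity) h0]
      linarith [le_abs_self B]
    refine isClosed_of_closure_subset fun s hs p hp => ?_
    have hs0 : ∀ k, p.1 k < 0 → s k ≠ 0 := by
      intro k hk
      obtain ⟨c, hc, h⟩ := hlow p hp k hk
      have : closure (boundedSet F) ⊆ {z | c ≤ ‖z k‖} :=
        closure_minimal h (isClosed_le continuous_const (by fun_prop))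
      exact norm_pos_iff.1 (hc.trans_le (this hs))
    refine ⟨hs0, ?_⟩
    have hcont : ContinuousAt (fun z : Fin n → ℂ => ‖∏ k, z k ^ p.1 k‖) s := by
      refine ContinuousAt.norm (tendsto_finsetProd _ fun k _ => ?_)
      refine (continuousAt_apply k s).zpow₀ _ ?_
      rcases lt_or_ge (p.1 k) 0 with h | h
      · exact Or.inl (hs0 k h)
      · exact Or.inr h
    have := mem_closure_iff_frequently.1 hs
    exact le_of_tendsto_of_frequently hcont (this.mono fun z hz => (hz p hp).2)
  · rw [isBounded_iff_forall_norm_le]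
    refine ⟨∑ k, |R k|, fun s hs => (pi_norm_le_iff_of_nonneg
      (Finset.sum_nonneg fun _ _ => abs_nonneg _)).2 fun k => ?_⟩
    have := (hs _ (hR k)).2
    simp only [prod_zpow_single, zpow_one] at this
    exact (this.trans (le_abs_self _)).trans
      (Finset.single_le_sum (f := fun k => |R k|) (fun _ _ => abs_nonneg _) (Finset.mem_univ k))

end MonomialBounds

/-! ### Monomials and characters -/

section Exponents

variable {n : ℕ}

/-- A natural multi-index as an integer multi-index. -/
def intExp (m : Fin n → ℕ) : Fin n → ℤ := fun k => m k

@[simp] lemma intExp_apply (m : Fin n → ℕ) (k : Fin n) : intExp m k = m k := rfl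

lemma intExp_nonneg (m : Fin n → ℕ) : 0 ≤ intExp m := fun k => Int.natCast_nonneg (m k)

lemma map_intExp {N : Type*} [CommMonoid N] {M : AddSubmonoid (Fin n → ℤ)}
    (hM : ∀ k, Pi.single k 1 ∈ M) (X : Multiplicative M →* N) (m : Fin n → ℕ)
    (hm : intExp m ∈ M) :
    X (Multiplicative.ofAdd ⟨intExp m, hm⟩) =
      ∏ k, X (Multiplicative.ofAdd ⟨Pi.single k 1, hM k⟩) ^ m k := by
  have h : (⟨intExp m, hm⟩ : M) = ∑ k, m k • (⟨Pi.single k 1, hM k⟩ : M) := by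
    ext l
    simp [Finset.sum_apply, Pi.single_apply]
  rw [h, ofAdd_sum, map_prod]
  simp only [ofAdd_nsmul, map_pow]

/-- Multiplying by the negative part of i reduces to natural exponents; the factor so introduced is
nonzero at s and can be divided out. -/
lemma map_eq_prod_zpow {M : AddSubmonoid (Fin n → ℤ)} (hpos : ∀ i, 0 ≤ i → i ∈ M)
    (χ : Multiplicative M →* ℂ) (s : Fin n → ℂ)
    (hs : ∀ k (hk : Pi.single k 1 ∈ M), χ (Multiplicative.ofAdd ⟨Pi.single k 1, hk⟩) = s k)
    (i : M) (hi : ∀ k, i.1 k < 0 → s k ≠ 0) :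
    χ (Multiplicative.ofAdd i) = ∏ k, s k ^ i.1 k := by
  have hM : ∀ k, Pi.single k 1 ∈ M := fun k => hpos _ (by simp)
  have hnat : ∀ (m : Fin n → ℕ) (hm : intExp m ∈ M),
      χ (Multiplicative.ofAdd ⟨intExp m, hm⟩) = ∏ k, s k ^ m k := fun m hm => by
    rw [map_intExp hM]
    simp only [hs]
  have hadd : i + ⟨intExp fun k => (-i.1 k).toNat, hpos _ (intExp_nonneg _)⟩ =
      ⟨intExp fun k => (i.1 k).toNat, hpos _ (intExp_nonneg _)⟩ := by
    ext k
    simp only [AddSubmonoid.coe_add, Pi.add_apply, intExp_apply]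
    omega
  have hmul := congrArg (fun j => χ (Multiplicative.ofAdd j)) hadd
  simp only [ofAdd_add, map_mul, hnat] at hmul
  rw [← eval_monomialNum_div, eval_monomialNum, eval_monomialNum, eq_div_iff, ← hmul]
  · rfl
  · have := eval_monomialNum_neg_ne_zero hi
    rwa [eval_monomialNum] at this

lemma norm_character_le {A : Type*} [NormedCommRing A] [NormedAlgebra ℂ A] [CompleteSpace A]
    (h1 : ‖(1 : A)‖ = 1) (φ : A →ₐ[ℂ] ℂ) (a : A) : ‖φ a‖ ≤ ‖a‖ := by
  have := AlgHom.norm_apply_le_self_mul_norm_one φ a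
  rwa [h1, mul_one] at this

lemma exists_character_eq_zero {A : Type*} [NormedCommRing A] [NormedAlgebra ℂ A]
    [CompleteSpace A] {a : A} (ha : ¬IsUnit a) : ∃ φ : A →ₐ[ℂ] ℂ, φ a = 0 := by
  obtain ⟨f, hf⟩ := WeakDual.CharacterSpace.exists_apply_eq_zero ha
  exact ⟨WeakDual.CharacterSpace.toAlgHom f, hf⟩

end Exponents

/-! ### Reciprocal Laurent series of a polynomial -/

section LaurentInverse

variable {n : ℕ}

/-- The formal Laurent series `c` is inverse to the polynomial `q`. -/
def IsLaurentInverse (q : MvPolynomial (Fin n) ℂ) (c : (Fin n → ℤ) → ℂ) : Prop :=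
  ∀ i, ∑ j ∈ q.support, q.coeff j * c (i - intExp j) = if i = 0 then 1 else 0

/-- The largest modulus of a monomial on the polyannulus with the radii `r` and `ρ`. -/
noncomputable def polyWeight (r ρ : Fin n → ℝ≥0) (i : Fin n → ℤ) : ℝ≥0 :=
  ∏ k, max (r k ^ i k) (ρ k ^ i k)

lemma polyWeight_zero (r ρ : Fin n → ℝ≥0) : polyWeight r ρ 0 = 1 := by simp [polyWeight]

lemma polyWeight_pos {r ρ : Fin n → ℝ≥0} (hρ : ∀ k, 0 < ρ k) (i : Fin n → ℤ) :
    0 < polyWeight r ρ i :=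
  Finset.prod_pos fun k _ => lt_max_of_lt_right (zpow_pos (hρ k) _)

lemma polyWeight_add_le {r ρ : Fin n → ℝ≥0} (hρ : ∀ k, 0 < ρ k) (i j : Fin n → ℤ) :
    polyWeight r ρ (i + j) ≤ polyWeight r ρ i * polyWeight r ρ j := by
  rw [polyWeight, polyWeight, polyWeight, ← Finset.prod_mul_distrib]
  refine Finset.prod_le_prod' fun k _ => max_le ?_ ?_
  · by_cases h : r k = 0
    · rw [h]
      by_cases hij : (i + j) k = 0
      · rw [hij, zpow_zero, ← zpow_zero (ρ k), ← hij, Pi.add_apply, zpow_add₀ (hρ k).ne']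
        exact mul_le_mul' (le_max_right _ _) (le_max_right _ _)
      · rw [zero_zpow _ hij]
        exact zero_le
    · rw [Pi.add_apply, zpow_add₀ h]
      exact mul_le_mul' (le_max_left _ _) (le_max_left _ _)
  · rw [Pi.add_apply, zpow_add₀ (hρ k).ne']
    exact mul_le_mul' (le_max_right _ _) (le_max_right _ _)

lemma norm_prod_zpow_le_polyWeight {r ρ : Fin n → ℝ≥0} {z : Fin n → ℂ}
    (hr : ∀ k, r k ≤ ‖z k‖) (hρ : ∀ k, ‖z k‖ ≤ ρ k) {i : Fin n → ℤ}
    (hi : ∀ k, r k = 0 → 0 ≤ i k) : ‖∏ k, z k ^ i k‖ ≤ polyWeight r ρ i := by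
  rw [norm_prod, polyWeight, NNReal.coe_prod]
  refine Finset.prod_le_prod (fun _ _ => norm_nonneg _) fun k _ => ?_
  rw [norm_zpow, NNReal.coe_max, NNReal.coe_zpow, NNReal.coe_zpow]
  rcases le_total 0 (i k) with h | h
  · exact le_max_of_le_right (zpow_le_zpow_left₀ h (norm_nonneg _) (hρ k))
  · rcases eq_or_ne (r k) 0 with h0 | h0
    · rw [le_antisymm h (hi k h0)]
      simp
    · refine le_max_of_le_left ?_
      have hr0 : (0 : ℝ) < r k := by exact_mod_cast pos_iff_ne_zero.2 h0
      have := inv_anti₀ (pow_pos hr0 (-i k).toNat) (pow_le_pow_left₀ hr0.le (hr k) (-i k).toNat)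
      rw [← zpow_natCast, ← zpow_natCast, Int.toNat_of_nonneg (by omega), zpow_neg, zpow_neg,
        inv_inv, inv_inv] at this
      exact this

/-- A Wiener-type argument: characters of the weighted ℓ¹ algebra are points of the closed
polyannulus, where q has no zeros. So q is invertible in the algebra, and the coefficients of its
inverse form the series. -/
theorem exists_isLaurentInverse (q : MvPolynomial (Fin n) ℂ) {r ρ : Fin n → ℝ≥0}
    (hrρ : ∀ k, r k ≤ ρ k) (hρ : ∀ k, 0 < ρ k)
    (hq : ∀ z : Fin n → ℂ, (∀ k, r k ≤ ‖z k‖) → (∀ k, ‖z k‖ ≤ ρ k) → MvPolynomial.eval z q ≠ 0) :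
    ∃ c, IsLaurentInverse q c ∧ (∀ i k, c i ≠ 0 → r k = 0 → 0 ≤ i k) ∧
      Summable fun i => ‖c i‖ * polyWeight r ρ i := by
  classical
  -- Negative exponents are allowed only where the inner radius is positive, since the other
  -- coordinates may vanish on the polyannulus.
  let M : AddSubmonoid (Fin n → ℤ) :=
    { carrier := {i | ∀ k, r k = 0 → 0 ≤ i k}
      zero_mem' := fun k _ => le_rfl
      add_mem' := fun hi hj k hk => add_nonneg (hi k hk) (hj k hk) }
  have hpos : ∀ i, 0 ≤ i → i ∈ M := fun i hi k _ => hi k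
  obtain ⟨A, _, _, _, X, hX, h1, hcoef⟩ := exists_weighted_algebra
    (fun i : M => polyWeight r ρ i) (polyWeight_zero r ρ)
    (fun i j => polyWeight_add_le hρ i j)
  obtain ⟨c, hsum, hone, hshift, hzero⟩ := hcoef fun i => polyWeight_pos hρ i
  let e : (Fin n →₀ ℕ) → M := fun j => ⟨intExp j, hpos _ (intExp_nonneg _)⟩
  let Q : A := ∑ j ∈ q.support, q.coeff j • X (Multiplicative.ofAdd (e j))
  have hQ : IsUnit Q := by
    by_contra hQ
    obtain ⟨φ, hφ⟩ := exists_character_eq_zero hQ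
    have hsing : ∀ k, Pi.single k 1 ∈ M := fun k => hpos _ (by simp)
    let s : Fin n → ℂ := fun k => φ (X (Multiplicative.ofAdd ⟨Pi.single k 1, hsing k⟩))
    have hw : ∀ k (z : ℤ), polyWeight r ρ (Pi.single k z) = max (r k ^ z) (ρ k ^ z) := by
      intro k z
      rw [polyWeight, Finset.prod_eq_single k]
      · simp
      · intro l _ hl
        simp [Pi.single_eq_of_ne hl]
      · simp
    have hup : ∀ k, ‖s k‖ ≤ ρ k := fun k => by
      refine (norm_character_le h1 φ _).trans (le_of_eq ?_)
      rw [hX, hw, zpow_one, zpow_one, max_eq_right (hrρ k)]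
    have hlow : ∀ k, r k ≤ ‖s k‖ := fun k => by
      by_cases hk : r k = 0
      · rw [hk]; exact norm_nonneg _
      have hk0 : 0 < r k := pos_iff_ne_zero.2 hk
      have hmem : Pi.single k (-1) ∈ M := by
        intro l hl
        rw [Pi.single_eq_of_ne (by rintro rfl; exact hk hl)]
      have hmul : s k * φ (X (Multiplicative.ofAdd ⟨Pi.single k (-1), hmem⟩)) = 1 := by
        rw [← map_mul, ← map_mul, ← ofAdd_add]
        have : (⟨Pi.single k 1, hsing k⟩ : M) + ⟨Pi.single k (-1), hmem⟩ = 0 := by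
          ext l
          simp [← Pi.single_add]
        rw [this, ofAdd_zero, map_one, map_one]
      have hn : ‖φ (X (Multiplicative.ofAdd ⟨Pi.single k (-1), hmem⟩))‖ ≤ (r k : ℝ)⁻¹ := by
        refine (norm_character_le h1 φ _).trans (le_of_eq ?_)
        rw [hX, hw, zpow_neg_one, zpow_neg_one, max_eq_left (inv_anti₀ hk0 (hrρ k)),
          NNReal.coe_inv]
      have h2 := congrArg norm hmul
      rw [norm_mul, norm_one] at h2
      have h3 : 1 ≤ ‖s k‖ * (r k : ℝ)⁻¹ :=
        h2.symm.le.trans (mul_le_mul_of_nonneg_left hn (norm_nonneg _))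
      rwa [← div_eq_mul_inv, one_le_div (by exact_mod_cast hk0)] at h3
    refine hq s hlow hup ?_
    rw [← hφ, MvPolynomial.eval_eq', map_sum]
    refine Finset.sum_congr rfl fun j _ => ?_
    rw [map_smul, smul_eq_mul]
    congr 1
    have := map_eq_prod_zpow hpos ((φ : A →* ℂ).comp X) s (fun k hk => rfl) (e j)
      (fun k hk => absurd hk (not_lt.2 (Int.natCast_nonneg _)))
    simpa [e] using this.symm
  obtain ⟨b, hb⟩ := hQ.exists_right_inv
  refine ⟨fun i => if h : i ∈ M then c b ⟨i, h⟩ else 0, ?_, ?_, ?_⟩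
  · intro i
    by_cases hi : i ∈ M
    · have h2 := hone ⟨i, hi⟩
      have h3 : (AddMonoidAlgebra.coeff (1 : AddMonoidAlgebra ℂ M)) ⟨i, hi⟩ =
          if i = 0 then 1 else 0 := by
        rw [AddMonoidAlgebra.one_def, AddMonoidAlgebra.coeff_single, Finsupp.single_apply]
        refine if_congr ?_ rfl rfl
        rw [eq_comm, ← Subtype.coe_inj]
        rfl
      rw [← h3, ← h2, ← hb, Finset.sum_mul, map_sum, Finset.sum_apply]
      refine Finset.sum_congr rfl fun j _ => ?_
      rw [smul_mul_assoc, map_smul, Pi.smul_apply, smul_eq_mul]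
      congr 1
      beta_reduce
      by_cases hij : i - intExp j ∈ M
      · rw [dif_pos hij]
        have h4 : (⟨i, hi⟩ : M) = e j + ⟨i - intExp j, hij⟩ := by
          ext k; simp [e]
        rw [h4, hshift]
        intro k hk
        exact add_left_cancel hk
      · rw [dif_neg hij, hzero]
        intro k hk
        refine hij ?_
        have h5 : i = intExp j + k.1 := (congrArg Subtype.val hk).symm
        rw [h5, add_sub_cancel_left]
        exact k.2
    · rw [if_neg (by rintro rfl; exact hi M.zero_mem)]
      refine Finset.sum_eq_zero fun j _ => ?_
      beta_reduce
      rw [dif_neg, mul_zero]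
      intro hij
      have := M.add_mem hij (hpos _ (intExp_nonneg j))
      rw [sub_add_cancel] at this
      exact hi this
  · intro i k hc
    have : i ∈ M := by
      by_contra h
      exact hc (dif_neg h)
    exact this k
  · rw [← Function.Injective.summable_iff (Subtype.val_injective (p := (· ∈ M)))]
    · refine summable_of_sum_le (c := ‖b‖)
        (fun i => mul_nonneg (norm_nonneg _) (NNReal.coe_nonneg _)) fun T => ?_
      refine le_of_eq_of_le (Finset.sum_congr rfl fun i _ => ?_) (hsum b T)
      simp
    · intro i hi
      have : i ∉ M := fun h => hi ⟨⟨i, h⟩, rfl⟩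
      simp [this]

/-- As for inverses in a ring, c = c * (q * d) = (c * q) * d = d. Absolute convergence under a
common multiplicative weight makes the convolution c * d exist; q has finitely many terms, so the
sums may be exchanged. -/
theorem IsLaurentInverse.unique {q : MvPolynomial (Fin n) ℂ} {c d : (Fin n → ℤ) → ℂ}
    (hc : IsLaurentInverse q c) (hd : IsLaurentInverse q d) {v : (Fin n → ℤ) → ℝ}
    (hv : ∀ i, 0 < v i) (hmul : ∀ i j, v (i + j) = v i * v j)
    (hcs : Summable fun i => ‖c i‖ * v i) (hds : Summable fun i => ‖d i‖ * v i) : c = d := by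
  have hconv : ∀ i, Summable fun k => c k * d (i - k) := by
    intro i
    refine Summable.of_norm_bounded
      (g := fun k => ‖c k‖ * v k * ((∑' l, ‖d l‖ * v l) / v i)) (hcs.mul_right _) fun k => ?_
    have h1 : ‖d (i - k)‖ * v (i - k) ≤ ∑' l, ‖d l‖ * v l :=
      hds.le_tsum (i - k) fun l _ => mul_nonneg (norm_nonneg _) (hv l).le
    have h2 : v i = v k * v (i - k) := by rw [← hmul, add_sub_cancel]
    rw [norm_mul, mul_assoc]
    refine mul_le_mul_of_nonneg_left ?_ (norm_nonneg _)
    rw [h2, ← mul_div_assoc, mul_div_mul_left _ _ (hv k).ne', le_div_iff₀ (hv _)]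
    exact h1
  have hfin : ∀ i, ∑' k, c k * (if i - k = 0 then (1 : ℂ) else 0) = c i := fun i => by
    rw [tsum_eq_single i]
    · simp
    · intro k hk
      rw [if_neg (sub_ne_zero.2 hk.symm), mul_zero]
  have hfin' : ∀ i, ∑' k, (if k = 0 then (1 : ℂ) else 0) * d (i - k) = d i := fun i => by
    rw [tsum_eq_single 0]
    · simp
    · intro k hk
      rw [if_neg hk, zero_mul]
  funext i
  rw [← hfin i, ← hfin' i]
  have hleft : ∑' k, c k * (if i - k = 0 then (1 : ℂ) else 0) =
      ∑ j ∈ q.support, q.coeff j * ∑' k, c k * d (i - intExp j - k) := by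
    have hswap := Summable.tsum_finsetSum (s := q.support)
      (f := fun (j : Fin n →₀ ℕ) k => q.coeff j * (c k * d (i - intExp j - k)))
      fun j _ => (hconv (i - intExp j)).mul_left (q.coeff j)
    simp only [tsum_mul_left] at hswap
    rw [← hswap]
    refine tsum_congr fun k => ?_
    rw [← hd (i - k), Finset.mul_sum]
    refine Finset.sum_congr rfl fun j _ => ?_
    rw [sub_right_comm]
    ring
  have hright : ∑' k, (if k = 0 then (1 : ℂ) else 0) * d (i - k) =
      ∑ j ∈ q.support, q.coeff j * ∑' k, c k * d (i - intExp j - k) := by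
    have hshift : ∀ j : Fin n →₀ ℕ, (fun k => c (k - intExp j) * d (i - k)) =
        (fun k => c k * d (i - intExp j - k)) ∘ (Equiv.subRight (intExp j)) := fun j => by
      funext k
      simp [sub_sub]
    have hs : ∀ j : Fin n →₀ ℕ, Summable fun k => c (k - intExp j) * d (i - k) := fun j => by
      rw [hshift j, Equiv.summable_iff]
      exact hconv _
    have ht : ∀ j : Fin n →₀ ℕ, ∑' k, c k * d (i - intExp j - k) =
        ∑' k, c (k - intExp j) * d (i - k) := fun j => by
      rw [hshift j]
      exact ((Equiv.subRight (intExp j)).tsum_eq _).symm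
    have hswap := Summable.tsum_finsetSum (s := q.support)
      (f := fun (j : Fin n →₀ ℕ) k => q.coeff j * (c (k - intExp j) * d (i - k)))
      fun j _ => (hs j).mul_left (q.coeff j)
    simp only [tsum_mul_left] at hswap
    simp only [ht]
    rw [← hswap]
    refine tsum_congr fun k => ?_
    rw [← hc k, Finset.sum_mul]
    refine Finset.sum_congr rfl fun j _ => ?_
    ring
  rw [hleft, hright]

end LaurentInverse

/-! ### The monomial hull and the rational hull -/

section MonomialHull

variable {n : ℕ}

/-- The monomial hull of `E`: the points at which every monomial that is defined on `E` is defined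
and bounded by its bounds on `E`. -/
def monomialHull (E : Set (Fin n → ℂ)) : Set (Fin n → ℂ) :=
  {s | ∀ i : Fin n → ℤ, (∀ k, i k < 0 → ∀ z ∈ E, z k ≠ 0) →
    (∀ k, i k < 0 → s k ≠ 0) ∧
      ∀ B : ℝ, (∀ z ∈ E, ‖∏ k, z k ^ i k‖ ≤ B) → ‖∏ k, s k ^ i k‖ ≤ B}

lemma exists_rotation_near (z e : ℂ) : ∃ α : ℂ, ‖α‖ = 1 ∧ ‖z - α * e‖ = |‖z‖ - ‖e‖| := by
  refine ⟨Complex.exp ((Complex.arg z - Complex.arg e : ℝ) * Complex.I),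
    Complex.norm_exp_ofReal_mul_I _, ?_⟩
  have h : Complex.exp ((Complex.arg z - Complex.arg e : ℝ) * Complex.I) * e =
      ‖e‖ * Complex.exp (Complex.arg z * Complex.I) := by
    nth_rewrite 2 [← Complex.norm_mul_exp_arg_mul_I e]
    rw [mul_left_comm, ← Complex.exp_add]
    congr 2
    push_cast
    ring
  rw [h]
  nth_rewrite 1 [← Complex.norm_mul_exp_arg_mul_I z]
  rw [← sub_mul, norm_mul, Complex.norm_exp_ofReal_mul_I, mul_one, ← Complex.ofReal_sub,
    Complex.norm_real, Real.norm_eq_abs]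

lemma exists_forall_ne_zero_of_isOpen {U : Set (Fin n → ℂ)} (hU : IsOpen U) (hne : U.Nonempty) :
    ∃ z ∈ U, ∀ k, z k ≠ 0 := by
  have hd : Dense (Set.pi Set.univ fun _ : Fin n => ({0}ᶜ : Set ℂ)) :=
    dense_pi _ fun k _ => dense_compl_singleton 0
  obtain ⟨z, hzU, hz⟩ := hd.inter_open_nonempty U hU hne
  exact ⟨z, hzU, fun k => hz k trivial⟩

/-- The inner radii of a small polyannulus around the torus through `e`. -/
noncomputable def innerRadius (δ : ℝ) (e : Fin n → ℂ) (k : Fin n) : ℝ≥0 :=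
  max (‖e k‖₊ - δ.toNNReal) (‖e k‖₊ / 2)

/-- The outer radii of a small polyannulus around the torus through `e`. -/
noncomputable def outerRadius (δ : ℝ) (e : Fin n → ℂ) (k : Fin n) : ℝ≥0 :=
  ‖e k‖₊ + δ.toNNReal

/-- The half modulus in the inner radius keeps it positive at nonzero coordinates even when δ
exceeds the modulus. -/
lemma innerRadius_eq_zero {δ : ℝ} {e : Fin n → ℂ} {k : Fin n} :
    innerRadius δ e k = 0 ↔ e k = 0 := by
  constructor
  · intro h
    have : ‖e k‖₊ / 2 ≤ 0 := h ▸ le_max_right _ _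
    simpa using this
  · intro h
    simp [innerRadius, h]

lemma innerRadius_le (δ : ℝ) (e : Fin n → ℂ) (k : Fin n) : innerRadius δ e k ≤ ‖e k‖₊ :=
  max_le tsub_le_self (half_le_self zero_le)

lemma innerRadius_lt {δ : ℝ} (hδ : 0 < δ) {e : Fin n → ℂ} {k : Fin n} (he : e k ≠ 0) :
    innerRadius δ e k < ‖e k‖₊ := by
  have h0 : 0 < ‖e k‖₊ := nnnorm_pos.2 he
  exact max_lt (tsub_lt_self h0 (Real.toNNReal_pos.2 hδ)) (half_lt_self h0)

/-- The open polyannulus around the torus through `e`. -/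
def openPolyannulus (δ : ℝ) (e : Fin n → ℂ) : Set (Fin n → ℂ) :=
  {z | ∀ k, ‖z k‖ < outerRadius δ e k ∧ (e k = 0 ∨ innerRadius δ e k < ‖z k‖)}

lemma isOpen_openPolyannulus (δ : ℝ) (e : Fin n → ℂ) : IsOpen (openPolyannulus δ e) := by
  simp only [openPolyannulus, Set.ofPred_forall]
  refine isOpen_iInter_of_finite fun k => ?_
  have hk : Continuous fun z : Fin n → ℂ => ‖z k‖ := by fun_prop
  exact (isOpen_lt hk continuous_const).inter (isOpen_const.union (isOpen_lt continuous_const hk))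

lemma mem_openPolyannulus_self {δ : ℝ} (hδ : 0 < δ) (e : Fin n → ℂ) :
    e ∈ openPolyannulus δ e := by
  intro k
  constructor
  · rw [← coe_nnnorm, NNReal.coe_lt_coe]
    exact lt_add_of_pos_right _ (Real.toNNReal_pos.2 hδ)
  · rw [or_iff_not_imp_left]
    intro h
    rw [← coe_nnnorm, NNReal.coe_lt_coe]
    exact innerRadius_lt hδ h

lemma innerRadius_le_of_mem {δ : ℝ} {e z : Fin n → ℂ} (hz : z ∈ openPolyannulus δ e) (k : Fin n) :
    innerRadius δ e k ≤ ‖z k‖ := by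
  rcases (hz k).2 with h | h
  · rw [innerRadius_eq_zero.2 h]
    exact norm_nonneg _
  · exact h.le

lemma norm_prod_zpow_le_of_mem_openPolyannulus {δ : ℝ} {e z : Fin n → ℂ}
    (hz : z ∈ openPolyannulus δ e) {i : Fin n → ℤ} (hi : ∀ k, e k = 0 → 0 ≤ i k) :
    ‖∏ k, z k ^ i k‖ ≤ polyWeight (innerRadius δ e) (outerRadius δ e) i :=
  norm_prod_zpow_le_polyWeight (innerRadius_le_of_mem hz) (fun k => (hz k).1.le)
    fun k hk => hi k (innerRadius_eq_zero.1 hk)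

/-- Rotating each coordinate of e to the argument of z gives a point of E whose distance from z is
the largest difference of moduli. -/
lemma mem_cthickening_of_mem_polyannulus {E : Set (Fin n → ℂ)} (hE : IsCircled E) {δ : ℝ}
    (hδ : 0 < δ) {e : Fin n → ℂ} (he : e ∈ E) {z : Fin n → ℂ}
    (hr : ∀ k, innerRadius δ e k ≤ ‖z k‖) (hρ : ∀ k, ‖z k‖ ≤ outerRadius δ e k) :
    z ∈ Metric.cthickening δ E := by
  choose α hα hz using fun k => exists_rotation_near (z k) (e k)
  refine Metric.mem_cthickening_of_dist_le z (fun k => α k * e k) δ E (hE e he α hα) ?_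
  rw [dist_eq_norm, pi_norm_le_iff_of_nonneg hδ.le]
  intro k
  rw [Pi.sub_apply, hz k, abs_le]
  have h1 := hρ k
  have h2 := hr k
  have h3 : ((‖e k‖₊ - δ.toNNReal : ℝ≥0) : ℝ) ≤ innerRadius δ e k :=
    NNReal.coe_le_coe.2 (le_max_left _ _)
  have h4 := NNReal.sub_def (r := ‖e k‖₊) (p := δ.toNNReal)
  have h5 : ‖e k‖ - δ ≤ ((‖e k‖₊ - δ.toNNReal : ℝ≥0) : ℝ) := by
    rw [h4, Real.coe_toNNReal', coe_nnnorm, Real.coe_toNNReal _ hδ.le]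
    exact le_max_left _ _
  rw [outerRadius, NNReal.coe_add, coe_nnnorm, Real.coe_toNNReal _ hδ.le] at h1
  constructor <;> linarith

/-- The formal Laurent series `c` is an inverse of `q` that converges absolutely on the polyannulus
around the torus through `e`. -/
def IsInverseNear (q : MvPolynomial (Fin n) ℂ) (δ : ℝ) (e : Fin n → ℂ)
    (c : (Fin n → ℤ) → ℂ) : Prop :=
  IsLaurentInverse q c ∧ (∀ i k, c i ≠ 0 → e k = 0 → 0 ≤ i k) ∧
    Summable fun i => ‖c i‖ * polyWeight (innerRadius δ e) (outerRadius δ e) i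

lemma IsInverseNear.summable {q : MvPolynomial (Fin n) ℂ} {δ : ℝ} {e : Fin n → ℂ}
    {c : (Fin n → ℤ) → ℂ} (hc : IsInverseNear q δ e c) {z : Fin n → ℂ}
    (hz : z ∈ openPolyannulus δ e) : Summable fun i => ‖c i‖ * ‖∏ k, z k ^ i k‖ := by
  refine hc.2.2.of_nonneg_of_le (fun i => mul_nonneg (norm_nonneg _) (norm_nonneg _)) fun i => ?_
  by_cases hi : c i = 0
  · simp [hi]
  · exact mul_le_mul_of_nonneg_left
      (norm_prod_zpow_le_of_mem_openPolyannulus hz fun k => hc.2.1 i k hi) (norm_nonneg _)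

/-- The two open polyannuli share e', hence also a point without zero coordinates. The moduli of the
monomials there form a multiplicative weight for which both series converge. -/
lemma IsInverseNear.unique {q : MvPolynomial (Fin n) ℂ} {δ : ℝ} (hδ : 0 < δ) {e e' : Fin n → ℂ}
    {c c' : (Fin n → ℤ) → ℂ} (hc : IsInverseNear q δ e c) (hc' : IsInverseNear q δ e' c')
    (he' : e' ∈ openPolyannulus δ e) : c' = c := by
  obtain ⟨z, ⟨hz, hz'⟩, hz0⟩ := exists_forall_ne_zero_of_isOpen
    ((isOpen_openPolyannulus δ e).inter (isOpen_openPolyannulus δ e'))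
    ⟨e', he', mem_openPolyannulus_self hδ _⟩
  refine hc'.1.unique hc.1 (v := fun i => ‖∏ k, z k ^ i k‖) (fun i => ?_)
    (fun i j => ?_) (hc'.summable hz') (hc.summable hz)
  · exact norm_pos_iff.2 (Finset.prod_ne_zero_iff.2 fun k _ => zpow_ne_zero _ (hz0 k))
  · rw [← norm_mul, ← Finset.prod_mul_distrib]
    simp only [Pi.add_apply, zpow_add₀ (hz0 _)]

/-- A polynomial without zeros on a connected circled compact set `E` has one formal Laurent series
inverse that converges absolutely around every point of `E`. -/
theorem exists_common_isInverseNear {E : Set (Fin n → ℂ)} (hcpt : IsCompact E)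
    (hconn : IsConnected E) (hcirc : IsCircled E) {q : MvPolynomial (Fin n) ℂ}
    (hq : ∀ z ∈ E, MvPolynomial.eval z q ≠ 0) :
    ∃ δ > 0, ∃ c, ∀ e ∈ E, IsInverseNear q δ e c := by
  obtain ⟨δ, hδ, hthick⟩ := hcpt.exists_cthickening_subset_open
    (t := {z | MvPolynomial.eval z q ≠ 0})
    (isOpen_ne_fun (continuous_eval q) continuous_const) hq
  have hlocal : ∀ e : E, ∃ c, IsInverseNear q δ (e : Fin n → ℂ) c := fun e => by
    obtain ⟨c, h1, h2, h3⟩ := exists_isLaurentInverse q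
      (fun k => (innerRadius_le δ (e : Fin n → ℂ) k).trans le_self_add)
      (fun k => lt_of_lt_of_le (Real.toNNReal_pos.2 hδ) le_add_self)
      (fun z hr hρ => hthick (mem_cthickening_of_mem_polyannulus hcirc hδ e.2 hr hρ))
    exact ⟨c, h1, fun i k hi hk => h2 i k hi (innerRadius_eq_zero.2 hk), h3⟩
  choose c hc using hlocal
  -- By uniqueness, the series at e serves all points of E near e; connectedness then makes it
  -- global.
  have hloc : IsLocallyConstant c := by
    rw [IsLocallyConstant.iff_eventually_eq]
    intro e
    have hopen : IsOpen (Subtype.val ⁻¹' openPolyannulus δ (e : Fin n → ℂ) : Set E) :=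
      (isOpen_openPolyannulus δ _).preimage continuous_subtype_val
    filter_upwards [hopen.mem_nhds (mem_openPolyannulus_self hδ _)] with e' he'
    exact (hc e).unique hδ (hc e') he'
  have : PreconnectedSpace E := Subtype.preconnectedSpace hconn.isPreconnected
  obtain ⟨e₀, he₀⟩ := hconn.nonempty
  refine ⟨δ, hδ, c ⟨e₀, he₀⟩, fun e he => ?_⟩
  rw [hloc.apply_eq_of_preconnectedSpace ⟨e₀, he₀⟩ ⟨e, he⟩]
  exact hc ⟨e, he⟩

lemma prod_zpow_add {s : Fin n → ℂ} {i j : Fin n → ℤ} (hi : ∀ k, i k < 0 → s k ≠ 0)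
    (hj : ∀ k, j k < 0 → s k ≠ 0) :
    ∏ k, s k ^ (i + j) k = (∏ k, s k ^ i k) * ∏ k, s k ^ j k := by
  rw [← Finset.prod_mul_distrib]
  refine Finset.prod_congr rfl fun k _ => ?_
  rw [Pi.add_apply, zpow_add']
  by_cases h : s k = 0
  · have h1 : ¬ i k < 0 := fun hk => hi k hk h
    have h2 : ¬ j k < 0 := fun hk => hj k hk h
    right
    omega
  · exact Or.inl h

/-- Summing the inverse relation at s gives q(s) times the value of the series equal to 1. -/
lemma IsLaurentInverse.eval_ne_zero {q : MvPolynomial (Fin n) ℂ} {c : (Fin n → ℤ) → ℂ}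
    (hc : IsLaurentInverse q c) {s : Fin n → ℂ} (hs : ∀ i, c i ≠ 0 → ∀ k, i k < 0 → s k ≠ 0)
    (hsum : Summable fun i => ‖c i‖ * ‖∏ k, s k ^ i k‖) : MvPolynomial.eval s q ≠ 0 := by
  have hsum' : Summable fun i => c i * ∏ k, s k ^ i k := by
    refine Summable.of_norm ?_
    simpa only [norm_mul] using hsum
  have hterm : ∀ (j : Fin n →₀ ℕ) i, c (i - intExp j) * ∏ k, s k ^ i k =
      (c (i - intExp j) * ∏ k, s k ^ (i - intExp j) k) * ∏ k, s k ^ j k := by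
    intro j i
    by_cases hi : c (i - intExp j) = 0
    · simp [hi]
    · have := prod_zpow_add (hs _ hi) (j := intExp j)
        (fun k hk => absurd hk (not_lt.2 (Int.natCast_nonneg _)))
      rw [sub_add_cancel] at this
      rw [this, mul_assoc]
      simp
  have hshift : ∀ j : Fin n →₀ ℕ, Summable fun i => c (i - intExp j) * ∏ k, s k ^ i k := by
    intro j
    simp only [hterm]
    exact ((Equiv.subRight (intExp j)).summable_iff.2 hsum').mul_right _
  have hval : ∀ j : Fin n →₀ ℕ, ∑' i, c (i - intExp j) * ∏ k, s k ^ i k =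
      (∑' i, c i * ∏ k, s k ^ i k) * ∏ k, s k ^ j k := by
    intro j
    simp only [hterm, tsum_mul_right]
    congr 1
    exact (Equiv.subRight (intExp j)).tsum_eq fun i => c i * ∏ k, s k ^ i k
  have hone : ∑' i : Fin n → ℤ, (if i = 0 then (1 : ℂ) else 0) * ∏ k, s k ^ i k = 1 := by
    rw [tsum_eq_single 0]
    · simp
    · intro i hi
      rw [if_neg hi, zero_mul]
  have hswap := Summable.tsum_finsetSum (s := q.support)
    (f := fun (j : Fin n →₀ ℕ) i => q.coeff j * (c (i - intExp j) * ∏ k, s k ^ i k))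
    fun j _ => (hshift j).mul_left (q.coeff j)
  have hleft : ∑' i, ∑ j ∈ q.support, q.coeff j * (c (i - intExp j) * ∏ k, s k ^ i k) = 1 := by
    simp only [← mul_assoc, ← Finset.sum_mul, hc _, hone]
  rw [hleft] at hswap
  simp only [tsum_mul_left, hval] at hswap
  intro h0
  rw [MvPolynomial.eval_eq'] at h0
  have : ∑ j ∈ q.support, q.coeff j * ((∑' i, c i * ∏ k, s k ^ i k) * ∏ k, s k ^ j k) = 0 := by
    rw [← mul_zero (∑' i, c i * ∏ k, s k ^ i k), ← h0, Finset.mul_sum]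
    exact Finset.sum_congr rfl fun j _ => by ring
  rw [this] at hswap
  exact one_ne_zero hswap

/-- The reciprocal series common to all of E also converges at s, because each of its monomials is
at s no larger than its bounds on E. -/
theorem eval_ne_zero_of_mem_monomialHull {E : Set (Fin n → ℂ)} (hcpt : IsCompact E)
    (hconn : IsConnected E) (hcirc : IsCircled E) {q : MvPolynomial (Fin n) ℂ}
    (hq : ∀ z ∈ E, MvPolynomial.eval z q ≠ 0) {s : Fin n → ℂ} (hs : s ∈ monomialHull E) :
    MvPolynomial.eval s q ≠ 0 := by
  obtain ⟨δ, hδ, c, hE⟩ := exists_common_isInverseNear hcpt hconn hcirc hq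
  obtain ⟨e₀, he₀⟩ := hconn.nonempty
  have hdef : ∀ i, c i ≠ 0 → ∀ k, i k < 0 → ∀ z ∈ E, z k ≠ 0 := fun i hi k hk z hz h0 =>
    absurd ((hE z hz).2.1 i k hi h0) (not_le.2 hk)
  obtain ⟨t, htE, hcover⟩ := hcpt.elim_nhds_subcover (openPolyannulus δ) fun e _ =>
    (isOpen_openPolyannulus δ e).mem_nhds (mem_openPolyannulus_self hδ e)
  refine (hE e₀ he₀).1.eval_ne_zero (fun i hi => (hs i (hdef i hi)).1) ?_
  -- Finitely many polyannuli cover E, so the sum of their weights bounds each occurring monomial on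
  -- all of E and is still summable against c.
  have hsum : Summable fun i => ∑ e ∈ t,
      ‖c i‖ * (polyWeight (innerRadius δ e) (outerRadius δ e) i : ℝ) :=
    summable_sum fun e he => (hE e (htE e he)).2.2
  refine hsum.of_nonneg_of_le (fun i => by positivity) fun i => ?_
  by_cases hi : c i = 0
  · simp [hi]
  rw [← Finset.mul_sum]
  refine mul_le_mul_of_nonneg_left ((hs i (hdef i hi)).2 _ fun z hz => ?_) (norm_nonneg _)
  obtain ⟨e, he, hze⟩ := Set.mem_iUnion₂.1 (hcover hz)
  refine (norm_prod_zpow_le_of_mem_openPolyannulus hze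
    fun k hk => (hE e (htE e he)).2.1 i k hi hk).trans ?_
  exact Finset.single_le_sum
    (f := fun e => (polyWeight (innerRadius δ e) (outerRadius δ e) i : ℝ))
    (fun _ _ => NNReal.coe_nonneg _) he

/-- The monomial hull of a connected circled compact set is contained in its rational hull. -/
theorem monomialHull_subset_rationalHull {E : Set (Fin n → ℂ)} (hcpt : IsCompact E)
    (hconn : IsConnected E) (hcirc : IsCircled E) : monomialHull E ⊆ rationalHull E := by
  intro s hs p q hq
  have hqs := eval_ne_zero_of_mem_monomialHull hcpt hconn hcirc hq hs
  refine ⟨hqs, ?_⟩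
  by_contra! hlt
  set l := MvPolynomial.eval s p / MvPolynomial.eval s q
  -- This polynomial vanishes at s by the choice of l; a zero of it on E would make p / q take the
  -- value l there, against `hlt`.
  refine eval_ne_zero_of_mem_monomialHull hcpt hconn hcirc (q := p - MvPolynomial.C l * q)
    (fun z hz h0 => ?_) hs ?_
  · have h1 : MvPolynomial.eval z p / MvPolynomial.eval z q = l := by
      rw [div_eq_iff (hq z hz)]
      simpa [sub_eq_zero] using h0
    have h2 := le_ciSup (bddAbove_norm_eval_div hcpt p q hq) ⟨z, hz⟩
    simp only [h1] at h2
    exact absurd hlt (not_lt.2 h2)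
  · simp [l, hqs]

/-- The bounds of the monomials on `E`. -/
def monomialBounds (E : Set (Fin n → ℂ)) : Set ((Fin n → ℤ) × ℝ) :=
  {p | (∀ k, p.1 k < 0 → ∀ z ∈ E, z k ≠ 0) ∧ ∀ z ∈ E, ‖∏ k, z k ^ p.1 k‖ ≤ p.2}

lemma bddAbove_norm_prod_zpow {E : Set (Fin n → ℂ)} (hE : IsCompact E) {i : Fin n → ℤ}
    (hi : ∀ k, i k < 0 → ∀ z ∈ E, z k ≠ 0) : ∃ B : ℝ, ∀ z ∈ E, ‖∏ k, z k ^ i k‖ ≤ B := by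
  refine hE.exists_bound_of_continuousOn (f := fun z => ∏ k, z k ^ i k) ?_
  refine continuousOn_finsetProd _ fun k _ => ?_
  refine (continuous_apply k).continuousOn.zpow₀ _ fun z hz => ?_
  rcases lt_or_ge (i k) 0 with h | h
  · exact Or.inl (hi k h z hz)
  · exact Or.inr h

/-- A rationally convex connected circled set is given by bounds on monomials. -/
theorem IsRCC.eq_boundedSet {E : Set (Fin n → ℂ)} (hE : IsRCC E) :
    E = boundedSet (monomialBounds E) := by
  refine Set.Subset.antisymm (fun s hs p hp => ⟨fun k hk => hp.1 k hk s hs, hp.2 s hs⟩) ?_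
  intro s hs
  rw [← hE.1.2]
  refine monomialHull_subset_rationalHull hE.1.1 hE.2.1 hE.2.2 fun i hi => ?_
  obtain ⟨B, hB⟩ := bddAbove_norm_prod_zpow hE.1.1 hi
  exact ⟨(hs (i, B) ⟨hi, hB⟩).1, fun B' hB' => (hs (i, B') ⟨hi, hB'⟩).2⟩

/-- A nonempty intersection of rationally convex connected circled sets is of the same kind. -/
theorem isRCC_sInter {𝓔 : Set (Set (Fin n → ℂ))} (hne : 𝓔.Nonempty) (h𝓔 : ∀ E ∈ 𝓔, IsRCC E)
    (hinter : (⋂₀ 𝓔).Nonempty) : IsRCC (⋂₀ 𝓔) := by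
  -- Intersecting the sets amounts to imposing all their monomial bounds at once.
  have heq : ⋂₀ 𝓔 = boundedSet (⋃ E ∈ 𝓔, monomialBounds E) := by
    ext s
    simp only [Set.mem_sInter, boundedSet, Set.mem_iUnion₂, Set.mem_ofPred_eq]
    constructor
    · rintro hs p ⟨E, hE, hp⟩
      have := hs E hE
      rw [(h𝓔 E hE).eq_boundedSet] at this
      exact this p hp
    · intro hs E hE
      rw [(h𝓔 E hE).eq_boundedSet]
      exact fun p hp => hs p ⟨E, hE, hp⟩
  have hcpt : IsCompact (⋂₀ 𝓔) := by
    obtain ⟨E, hE⟩ := hne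
    exact (h𝓔 E hE).1.1.of_isClosed_subset
      (isClosed_sInter fun E hE => (h𝓔 E hE).1.1.isClosed) (Set.sInter_subset_of_mem hE)
  rw [heq] at hcpt hinter ⊢
  exact isRCC_boundedSet hinter hcpt

end MonomialHull

/-! ### Finiteness of the numbers C_i for i in M -/

section RatioSup

variable {n : ℕ} {a : (Fin n → ℕ) → ℝ≥0}

/-- A finite C_i excludes a positive number over zero, so the product form holds also when a m = 0.
-/
lemma le_ratioSup_mul {i : Fin n → ℤ} (hi : ratioSup a i < ∞) {m m' : Fin n → ℕ}
    (h : intExp m' = intExp m + i) : a m' ≤ (ratioSup a i).toNNReal * a m := by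
  by_cases h0 : a m = 0 ∧ a m' = 0
  · simp [h0]
  have hmem : (m, m') ∈ shiftPairs a i := ⟨fun k => congrFun h k, h0⟩
  have hle : (a m' : ℝ≥0∞) / a m ≤ ratioSup a i := by
    rw [ratioSup, if_pos ⟨_, hmem⟩]
    exact le_iSup₂_of_le (m, m') hmem le_rfl
  have hm : a m ≠ 0 := by
    intro hm
    rw [hm, ENNReal.coe_zero, ENNReal.div_zero] at hle
    · exact absurd (hle.trans_lt hi) (lt_irrefl _)
    · exact_mod_cast fun h' => h0 ⟨hm, h'⟩
  rw [ENNReal.div_le_iff_le_mul (Or.inl (by exact_mod_cast hm)) (Or.inl ENNReal.coe_ne_top),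
    ← ENNReal.coe_toNNReal hi.ne] at hle
  exact_mod_cast hle

lemma ratioSup_le {i : Fin n → ℤ} (hne : (shiftPairs a i).Nonempty) {c : ℝ≥0}
    (hc : ∀ m m' : Fin n → ℕ, intExp m' = intExp m + i → a m' ≤ c * a m) : ratioSup a i ≤ c := by
  rw [ratioSup, if_pos hne]
  refine iSup₂_le fun p hp => ENNReal.div_le_of_le_mul ?_
  exact_mod_cast hc p.1 p.2 (funext hp.1)

/-- The product of the bounds for division by the coordinates. -/
noncomputable def divBound (a : (Fin n → ℕ) → ℝ≥0) (q : Fin n → ℕ) : ℝ≥0 :=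
  ∏ k, (ratioSup a (-Pi.single k 1)).toNNReal ^ q k

lemma divBound_add (q q' : Fin n → ℕ) : divBound a (q + q') = divBound a q * divBound a q' := by
  simp [divBound, pow_add, Finset.prod_mul_distrib]

lemma divBound_zero : divBound a 0 = 1 := by simp [divBound]

lemma divBound_single (k : Fin n) (t : ℕ) :
    divBound a (Pi.single k t) = (ratioSup a (-Pi.single k 1)).toNNReal ^ t := by
  rw [divBound, Finset.prod_eq_single k]
  · simp
  · intro l _ hl
    simp [Pi.single_eq_of_ne hl]
  · simp

/-- The multi-index `q` is supported on the directions in which division is bounded. -/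
def IsFiniteExp (a : (Fin n → ℕ) → ℝ≥0) (q : Fin n → ℕ) : Prop :=
  ∀ k, q k ≠ 0 → k ∈ finiteDirs a

lemma IsFiniteExp.add {q q' : Fin n → ℕ} (h : IsFiniteExp a q) (h' : IsFiniteExp a q') :
    IsFiniteExp a (q + q') := by
  intro k hk
  by_cases h0 : q k = 0
  · exact h' k (by simpa [h0] using hk)
  · exact h k h0

lemma isFiniteExp_zero : IsFiniteExp a 0 := fun _ hk => absurd rfl hk

lemma isFiniteExp_single {k : Fin n} (hk : k ∈ finiteDirs a) (t : ℕ) :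
    IsFiniteExp a (Pi.single k t) := by
  intro l hl
  by_cases h : l = k
  · rwa [h]
  · exact absurd (Pi.single_eq_of_ne h _) hl

lemma le_divBound_single_mul {k : Fin n} (hk : k ∈ finiteDirs a) (t : ℕ) (m : Fin n → ℕ) :
    a m ≤ divBound a (Pi.single k t) * a (m + Pi.single k t) := by
  rw [divBound_single]
  induction t with
  | zero => simp
  | succ t ih =>
    have h := le_ratioSup_mul (a := a) (i := -Pi.single k 1) hk
      (m := m + Pi.single k (t + 1)) (m' := m + Pi.single k t) (by
        funext l
        by_cases hl : l = k
        · subst hl; simp; ring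
        · simp [Pi.single_eq_of_ne hl])
    rw [pow_succ, mul_assoc]
    exact ih.trans (mul_le_mul_right h _)

lemma le_divBound_mul {q : Fin n → ℕ} (hq : IsFiniteExp a q) (m : Fin n → ℕ) :
    a m ≤ divBound a q * a (m + q) := by
  have key : ∀ T : Finset (Fin n), a m ≤ divBound a (∑ k ∈ T, Pi.single k (q k)) *
      a (m + ∑ k ∈ T, Pi.single k (q k)) := by
    classical
    intro T
    induction T using Finset.induction_on with
    | empty => simp [divBound_zero]
    | insert k T hk ih =>
      rw [Finset.sum_insert hk, add_comm (Pi.single k (q k) : Fin n → ℕ), divBound_add, ← add_assoc]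
      by_cases h0 : q k = 0
      · simpa [h0, divBound_zero] using ih
      · rw [mul_assoc]
        exact ih.trans (mul_le_mul_right (le_divBound_single_mul (hq k h0) _ _) _)
  have := key Finset.univ
  rwa [Finset.univ_sum_single] at this

lemma ne_zero_of_isFiniteExp (ha0 : a 0 = 1) {q : Fin n → ℕ} (hq : IsFiniteExp a q) :
    a q ≠ 0 := by
  intro h
  have := le_divBound_mul hq 0
  rw [ha0, zero_add, h, mul_zero] at this
  exact absurd this (not_le.2 one_pos)

/-- The positive part of an integer multi-index. -/
def posPart (i : Fin n → ℤ) : Fin n → ℕ := fun k => (i k).toNat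

/-- The negative part of an integer multi-index. -/
def negPart (i : Fin n → ℤ) : Fin n → ℕ := fun k => (-i k).toNat

lemma intExp_posPart (i : Fin n → ℤ) : intExp (posPart i) = intExp (negPart i) + i := by
  funext k
  simp only [intExp, posPart, negPart, Pi.add_apply]
  omega

lemma isFiniteExp_negPart {i : Fin n → ℤ} (hi : i ∈ admissibleExps a) :
    IsFiniteExp a (negPart i) := by
  intro k hk
  by_contra h
  have := hi k h
  exact hk (Int.toNat_of_nonpos (by omega))

lemma shiftPairs_nonempty (ha0 : a 0 = 1) {i : Fin n → ℤ} (hi : i ∈ admissibleExps a) :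
    (shiftPairs a i).Nonempty :=
  ⟨(negPart i, posPart i), fun k => congrFun (intExp_posPart i) k,
    fun h => ne_zero_of_isFiniteExp ha0 (isFiniteExp_negPart hi) h.1⟩

/-- Raise m' by the negative part of i, at the cost of a division bound; the result is m plus the
positive part, where submultiplicativity applies. -/
lemma ratioSup_lt_top (ha0 : a 0 = 1) (hmul : ∀ i j, a (i + j) ≤ a i * a j) {i : Fin n → ℤ}
    (hi : i ∈ admissibleExps a) : ratioSup a i < ∞ := by
  refine lt_of_le_of_lt (ratioSup_le (c := divBound a (negPart i) * a (posPart i))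
    (shiftPairs_nonempty ha0 hi) fun m m' h => ?_) ENNReal.coe_lt_top
  have h1 : m' + negPart i = posPart i + m := by
    funext k
    have h2 := congrFun h k
    have h3 := congrFun (intExp_posPart i) k
    simp only [intExp, Pi.add_apply] at h2 h3 ⊢
    omega
  calc a m' ≤ divBound a (negPart i) * a (m' + negPart i) :=
        le_divBound_mul (isFiniteExp_negPart hi) m'
    _ ≤ divBound a (negPart i) * (a (posPart i) * a m) := by
        rw [h1]
        exact mul_le_mul_right (hmul _ _) _
    _ = _ := (mul_assoc _ _ _).symm

/-- The admissible exponents form a monoid. -/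
def admissibleMonoid (a : (Fin n → ℕ) → ℝ≥0) : AddSubmonoid (Fin n → ℤ) where
  carrier := admissibleExps a
  zero_mem' := fun _ _ => le_rfl
  add_mem' := fun hi hj k hk => add_nonneg (hi k hk) (hj k hk)

lemma mem_admissibleExps_of_nonneg {i : Fin n → ℤ} (hi : 0 ≤ i) : i ∈ admissibleExps a :=
  fun k _ => hi k

lemma single_mem_admissibleExps (k : Fin n) : Pi.single k 1 ∈ admissibleExps a :=
  mem_admissibleExps_of_nonneg (by simp)

lemma neg_single_mem_admissibleExps {k : Fin n} (hk : k ∈ finiteDirs a) :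
    -Pi.single k 1 ∈ admissibleExps a := by
  intro l hl
  have : l ≠ k := by rintro rfl; exact hl hk
  simp [Pi.single_eq_of_ne this]

lemma mem_finiteDirs_of_neg {i : Fin n → ℤ} (hi : i ∈ admissibleExps a) {k : Fin n}
    (hk : i k < 0) : k ∈ finiteDirs a := by
  by_contra h
  exact absurd (hi k h) (not_le.2 hk)

end RatioSup

/-! ### Two submultiplicative weights on M -/

section Weights

lemma le_sInf_mul {U : Set ℝ≥0} (hU : U.Nonempty) {x v : ℝ≥0} (h : ∀ u ∈ U, x ≤ u * v) :
    x ≤ sInf U * v := by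
  rcases eq_or_ne v 0 with rfl | hv
  · obtain ⟨u, hu⟩ := hU
    simpa using h u hu
  · rw [← div_le_iff₀ (pos_iff_ne_zero.2 hv)]
    exact le_csInf hU fun u hu => (div_le_iff₀ (pos_iff_ne_zero.2 hv)).2 (h u hu)

lemma sInf_le_sInf_mul_sInf {U V W : Set ℝ≥0} (hU : U.Nonempty) (hV : V.Nonempty)
    (h : ∀ u ∈ U, ∀ v ∈ V, ∃ w ∈ W, w ≤ u * v) : sInf W ≤ sInf U * sInf V := by
  rw [mul_comm]
  refine le_sInf_mul hV fun v hv => ?_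
  rw [mul_comm]
  refine le_sInf_mul hU fun u hu => ?_
  obtain ⟨w, hw, hle⟩ := h u hu v hv
  exact (csInf_le' hw).trans hle

variable {n : ℕ} {a : (Fin n → ℕ) → ℝ≥0}

/-- The bounds for the quotients `a (m + i) / a m` with `m` large in the directions in which
division is bounded. -/
def eventualBounds (a : (Fin n → ℕ) → ℝ≥0) (i : Fin n → ℤ) : Set ℝ≥0 :=
  {c | ∃ q, IsFiniteExp a q ∧
    ∀ m m' : Fin n → ℕ, q ≤ m → intExp m' = intExp m + i → a m' ≤ c * a m}

lemma ratioSup_mem_eventualBounds {i : Fin n → ℤ} (hi : ratioSup a i < ∞) :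
    (ratioSup a i).toNNReal ∈ eventualBounds a i :=
  ⟨0, isFiniteExp_zero, fun _ _ _ h => le_ratioSup_mul hi h⟩

/-- The passage from m to m + i + j goes through m + i, which may have negative entries for small m.
Hence C is not evidently submultiplicative, and only large m are used. -/
lemma mul_mem_eventualBounds {i j : Fin n → ℤ} (hi : i ∈ admissibleExps a) {c d : ℝ≥0}
    (hc : c ∈ eventualBounds a i) (hd : d ∈ eventualBounds a j) :
    c * d ∈ eventualBounds a (i + j) := by
  obtain ⟨q, hq, hqc⟩ := hc
  obtain ⟨p, hp, hpd⟩ := hd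
  -- The summand `negPart i` ensures that m + i is a natural multi-index and still lies above p.
  refine ⟨q + p + negPart i, (hq.add hp).add (isFiniteExp_negPart hi), fun m m' hm h => ?_⟩
  have hm' : ∀ k, q k + p k + (-i k).toNat ≤ m k := hm
  let l : Fin n → ℕ := fun k => (m k + i k).toNat
  have hl : intExp l = intExp m + i := by
    funext k
    have := hm' k
    simp only [intExp, l, Pi.add_apply]
    omega
  have h1 := hqc m l (fun k => by have := hm' k; change q k ≤ m k; omega) hl
  have h2 := hpd l m' (fun k => by
    have := hm' k
    change p k ≤ (m k + i k).toNat
    omega) (by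
    rw [h, hl, add_assoc])
  calc a m' ≤ d * a l := h2
    _ ≤ d * (c * a m) := mul_le_mul_right h1 _
    _ = c * d * a m := by ring

lemma sInf_eventualBounds_zero (ha0 : a 0 = 1) : sInf (eventualBounds a 0) = 1 := by
  have h1 : (1 : ℝ≥0) ∈ eventualBounds a 0 := ⟨0, isFiniteExp_zero, fun m m' _ h => by
    have : m' = m := funext fun k => by simpa using congrFun h k
    rw [this, one_mul]⟩
  refine le_antisymm (csInf_le' h1) (le_csInf ⟨1, h1⟩ ?_)
  rintro c ⟨q, hq, h⟩
  have h2 := h q q le_rfl (add_zero _).symm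
  have h3 := pos_iff_ne_zero.2 (ne_zero_of_isFiniteExp ha0 hq)
  exact le_of_mul_le_mul_right (by rwa [one_mul]) h3

/-- The norms that are forced on `x ^ m` when `x ^ i` has norm at most `C_i` and the coordinates in
the directions in which division is bounded are inverted. -/
def extensionNorms (a : (Fin n → ℕ) → ℝ≥0) (i m : Fin n → ℤ) : Set ℝ≥0 :=
  {x | ∃ (j : ℕ) (p q : Fin n → ℕ), IsFiniteExp a q ∧ m + intExp q = intExp p + j • i ∧
    x = (ratioSup a i).toNNReal ^ j * divBound a q * a p}

lemma extensionNorms_nonempty (i : Fin n → ℤ) {m : Fin n → ℤ} (hm : m ∈ admissibleExps a) :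
    (extensionNorms a i m).Nonempty :=
  ⟨_, 0, posPart m, negPart m, isFiniteExp_negPart hm, by
    rw [zero_smul, add_zero, intExp_posPart, add_comm], rfl⟩

/-- Go from p to m in j steps of size i; all intermediate exponents lie between the two ends, hence
are nonnegative. -/
lemma le_pow_mul {i : Fin n → ℤ} (hi : ratioSup a i < ∞) (j : ℕ) (p m : Fin n → ℕ)
    (h : intExp m = intExp p + j • i) : a m ≤ (ratioSup a i).toNNReal ^ j * a p := by
  induction j generalizing p with
  | zero =>
    have : m = p := funext fun k => by simpa using congrFun h k
    simp [this]
  | succ j ih =>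
    have hk : ∀ k, 0 ≤ (p k : ℤ) + i k := fun k => by
      have h1 : (m k : ℤ) = p k + (j + 1 : ℕ) • i k := congrFun h k
      rw [nsmul_eq_mul] at h1
      push_cast at h1
      by_contra! hlt
      nlinarith [Int.natCast_nonneg (m k), Int.natCast_nonneg (p k), Int.natCast_nonneg j]
    let p' : Fin n → ℕ := fun k => (p k + i k).toNat
    have hp' : intExp p' = intExp p + i := by
      funext k
      have := hk k
      simp only [intExp, p', Pi.add_apply]
      omega
    have h1 := ih p' (by rw [h, hp', succ_nsmul']; abel)
    rw [pow_succ, mul_assoc]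
    exact h1.trans (mul_le_mul_right (le_ratioSup_mul hi hp') _)

/-- The new weight does not lower the given norms: any forced bound, obtained by j steps of size i
and division by q, is already satisfied by a. -/
lemma sInf_extensionNorms_intExp {i : Fin n → ℤ} (hi : ratioSup a i < ∞) (m : Fin n → ℕ) :
    sInf (extensionNorms a i (intExp m)) = a m := by
  have hmem : a m ∈ extensionNorms a i (intExp m) :=
    ⟨0, m, 0, isFiniteExp_zero, by funext k; simp, by simp [divBound_zero]⟩
  refine le_antisymm (csInf_le' hmem) (le_csInf ⟨_, hmem⟩ ?_)
  rintro _ ⟨j, p, q, hq, h, rfl⟩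
  have h1 := le_pow_mul hi j p (m + q) (by rw [← h]; funext k; simp)
  calc a m ≤ divBound a q * a (m + q) := le_divBound_mul hq m
    _ ≤ divBound a q * ((ratioSup a i).toNNReal ^ j * a p) := mul_le_mul_right h1 _
    _ = _ := by ring

lemma sInf_extensionNorms_add_le (hmul : ∀ i j, a (i + j) ≤ a i * a j) (i : Fin n → ℤ)
    {m m' : Fin n → ℤ} (hm : m ∈ admissibleExps a) (hm' : m' ∈ admissibleExps a) :
    sInf (extensionNorms a i (m + m')) ≤
      sInf (extensionNorms a i m) * sInf (extensionNorms a i m') := by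
  refine sInf_le_sInf_mul_sInf (extensionNorms_nonempty i hm) (extensionNorms_nonempty i hm') ?_
  rintro _ ⟨j, p, q, hq, h, rfl⟩ _ ⟨j', p', q', hq', h', rfl⟩
  refine ⟨_, ⟨j + j', p + p', q + q', hq.add hq', ?_, rfl⟩, ?_⟩
  · have e : ∀ u v : Fin n → ℕ, intExp (u + v) = intExp u + intExp v := fun u v => by
      funext k; simp
    rw [e, e, add_smul, add_add_add_comm, h, h']
    abel
  · rw [divBound_add, pow_add]
    calc _ ≤ (ratioSup a i).toNNReal ^ j * (ratioSup a i).toNNReal ^ j' *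
          (divBound a q * divBound a q') * (a p * a p') := mul_le_mul_right (hmul _ _) _
      _ = _ := by ring

lemma sInf_extensionNorms_self_le (ha0 : a 0 = 1) (i : Fin n → ℤ) :
    sInf (extensionNorms a i i) ≤ (ratioSup a i).toNNReal :=
  csInf_le' ⟨1, 0, 0, isFiniteExp_zero, by funext k; simp, by simp [divBound_zero, ha0]⟩

lemma sInf_extensionNorms_neg_single_le (ha0 : a 0 = 1) (i : Fin n → ℤ) {k : Fin n}
    (hk : k ∈ finiteDirs a) : sInf (extensionNorms a i (-Pi.single k 1)) ≤
      (ratioSup a (-Pi.single k 1)).toNNReal :=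
  csInf_le' ⟨0, 0, Pi.single k 1, isFiniteExp_single hk 1, by
    funext l
    by_cases hl : l = k
    · subst hl; simp
    · simp [Pi.single_eq_of_ne hl], by simp [divBound_single, ha0]⟩

end Weights

/-! ### The set K: compactness, nonemptiness, maximality -/

section MonomialSet

variable {n : ℕ} {a : (Fin n → ℕ) → ℝ≥0}

/-- The bounds defining the set `K`. -/
def ratioBounds (a : (Fin n → ℕ) → ℝ≥0) : Set ((Fin n → ℤ) × ℝ) :=
  (fun i => (i, (ratioSup a i).toReal)) '' admissibleExps a

lemma enorm_le_iff_norm_le {z : ℂ} {c : ℝ≥0∞} (hc : c ≠ ∞) : ‖z‖ₑ ≤ c ↔ ‖z‖ ≤ c.toReal := by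
  rw [← ofReal_norm, ENNReal.ofReal_le_iff_le_toReal hc]

lemma monomialSet_eq_boundedSet (ha0 : a 0 = 1) (hmul : ∀ i j, a (i + j) ≤ a i * a j) :
    monomialSet a = boundedSet (ratioBounds a) := by
  ext s
  constructor
  · rintro hs _ ⟨i, hi, rfl⟩
    exact ⟨(hs i hi).1, (enorm_le_iff_norm_le (ratioSup_lt_top ha0 hmul hi).ne).1 (hs i hi).2⟩
  · intro hs i hi
    have := hs (i, (ratioSup a i).toReal) ⟨i, hi, rfl⟩
    exact ⟨this.1, (enorm_le_iff_norm_le (ratioSup_lt_top ha0 hmul hi).ne).2 this.2⟩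

lemma isCompact_monomialSet (ha0 : a 0 = 1) (hmul : ∀ i j, a (i + j) ≤ a i * a j) :
    IsCompact (monomialSet a) := by
  rw [monomialSet_eq_boundedSet ha0 hmul]
  refine isCompact_boundedSet (fun k => ⟨_, _, single_mem_admissibleExps k, rfl⟩) ?_
  rintro _ ⟨i, hi, rfl⟩ k hk
  exact ⟨_, _, neg_single_mem_admissibleExps (mem_finiteDirs_of_neg hi hk), rfl⟩

lemma apply_single_ne_zero (χ : Multiplicative (admissibleMonoid a) →* ℂ) {k : Fin n}
    (hk : k ∈ finiteDirs a) :
    χ (Multiplicative.ofAdd ⟨Pi.single k 1, single_mem_admissibleExps k⟩) ≠ 0 := by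
  have h : (⟨Pi.single k 1, single_mem_admissibleExps k⟩ : admissibleMonoid a) +
      ⟨-Pi.single k 1, neg_single_mem_admissibleExps hk⟩ = 0 := by
    ext l
    simp
  have h2 := congrArg (fun i => χ (Multiplicative.ofAdd i)) h
  simp only [ofAdd_add, map_mul, ofAdd_zero, map_one] at h2
  exact left_ne_zero_of_mul_eq_one h2

/-- A commutative Banach algebra realizing a submultiplicative weight on the admissible exponents,
with the values of its characters. -/
theorem exists_admissible_algebra (w : (Fin n → ℤ) → ℝ≥0) (hw0 : w 0 = 1)
    (hw : ∀ i ∈ admissibleExps a, ∀ j ∈ admissibleExps a, w (i + j) ≤ w i * w j) :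
    ∃ (A : Type u) (_ : NormedCommRing A) (_ : NormedAlgebra ℂ A) (_ : CompleteSpace A)
      (x : Fin n → A), (∀ m : Fin n → ℕ, ‖∏ k, x k ^ m k‖ = w (intExp m)) ∧
      (jointSpectrum x).Nonempty ∧ ∀ s ∈ jointSpectrum x, ∀ i ∈ admissibleExps a,
        (∀ k, i k < 0 → s k ≠ 0) ∧ ‖∏ k, s k ^ i k‖ ≤ w i := by
  obtain ⟨A, _, _, _, X₀, hX₀, -, -⟩ := exists_weighted_algebra
    (fun i : admissibleMonoid a => w i) hw0 (fun i j => hw i i.2 j j.2)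
  -- Lifting moves the algebra to the universe over which `ForcedInHull` quantifies.
  let X : Multiplicative (admissibleMonoid a) →* ULift.{u} A :=
    (MulEquiv.ulift.symm : A ≃* ULift.{u} A).toMonoidHom.comp X₀
  have hX : ∀ i, ‖X (Multiplicative.ofAdd i)‖ = w i := hX₀
  have h1 : ‖(1 : ULift.{u} A)‖ = 1 := by
    rw [← map_one X, ← ofAdd_zero, hX]
    exact congrArg NNReal.toReal hw0
  have hpos : ∀ i, 0 ≤ i → i ∈ admissibleMonoid a := fun i hi => mem_admissibleExps_of_nonneg hi
  refine ⟨ULift.{u} A, inferInstance, inferInstance, inferInstance,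
    fun k => X (Multiplicative.ofAdd ⟨Pi.single k 1, single_mem_admissibleExps k⟩), ?_, ?_, ?_⟩
  · intro m
    rw [← map_intExp single_mem_admissibleExps X m (hpos _ (intExp_nonneg m)), hX]
  · have : Nontrivial (ULift.{u} A) := ⟨⟨0, 1, fun h => by
      rw [← h, norm_zero] at h1
      exact zero_ne_one h1⟩⟩
    obtain ⟨φ, -⟩ := exists_character_eq_zero (not_isUnit_zero (M₀ := ULift.{u} A))
    exact ⟨_, φ, rfl⟩
  · rintro _ ⟨φ, rfl⟩ i hi
    let χ : Multiplicative (admissibleMonoid a) →* ℂ := (φ : ULift.{u} A →* ℂ).comp X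
    have hne : ∀ k, i k < 0 →
        φ (X (Multiplicative.ofAdd ⟨Pi.single k 1, single_mem_admissibleExps k⟩)) ≠ 0 :=
      fun k hk => apply_single_ne_zero χ (mem_finiteDirs_of_neg hi hk)
    refine ⟨hne, ?_⟩
    rw [← map_eq_prod_zpow hpos χ _ (fun k hk => rfl) ⟨i, hi⟩ hne]
    exact (norm_character_le h1 φ _).trans (hX ⟨i, hi⟩).le

/-- A nonzero commutative Banach algebra has a character. In the algebra of the weight given by
eventual bounds, which lies below C on M, its values at the generators form a point of K. -/
lemma monomialSet_nonempty (ha0 : a 0 = 1) (hmul : ∀ i j, a (i + j) ≤ a i * a j) :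
    (monomialSet a).Nonempty := by
  obtain ⟨A, _, _, _, x, -, ⟨s, hs⟩, hσ⟩ := exists_admissible_algebra.{0} (a := a)
    (fun i => sInf (eventualBounds a i)) (sInf_eventualBounds_zero ha0)
    (fun i hi j hj => sInf_le_sInf_mul_sInf
      ⟨_, ratioSup_mem_eventualBounds (ratioSup_lt_top ha0 hmul hi)⟩
      ⟨_, ratioSup_mem_eventualBounds (ratioSup_lt_top ha0 hmul hj)⟩
      fun c hc d hd => ⟨c * d, mul_mem_eventualBounds hi hc hd, le_rfl⟩)
  rw [monomialSet_eq_boundedSet ha0 hmul]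
  refine ⟨s, ?_⟩
  rintro _ ⟨i, hi, rfl⟩
  refine ⟨(hσ s hs i hi).1, (hσ s hs i hi).2.trans ?_⟩
  exact NNReal.coe_le_coe.2
    (csInf_le' (ratioSup_mem_eventualBounds (ratioSup_lt_top ha0 hmul hi)))

theorem isRCC_monomialSet (ha0 : a 0 = 1) (hmul : ∀ i j, a (i + j) ≤ a i * a j) :
    IsRCC (monomialSet a) := by
  have hne := monomialSet_nonempty ha0 hmul
  have hcpt := isCompact_monomialSet ha0 hmul
  rw [monomialSet_eq_boundedSet ha0 hmul] at hne hcpt ⊢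
  exact isRCC_boundedSet hne hcpt

/-- The bounds on the coordinates, their inverses where these are bounded, and one more monomial. -/
def singleBounds (a : (Fin n → ℕ) → ℝ≥0) (i : Fin n → ℤ) : Set ((Fin n → ℤ) × ℝ) :=
  {p | (∃ k, p = (Pi.single k 1, (a (Pi.single k 1) : ℝ))) ∨
    (∃ k ∈ finiteDirs a, p = (-Pi.single k 1, (ratioSup a (-Pi.single k 1)).toReal)) ∨
    p = (i, (ratioSup a i).toReal)}

/-- One algebra for each i suffices: it realizes a, and its spectrum lies in a compact set of
monomial bounds that includes the bound C_i. The least set E, and with it L, lies in that set. -/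
theorem subset_monomialSet (ha0 : a 0 = 1) (hmul : ∀ i j, a (i + j) ≤ a i * a j)
    {L : Set (Fin n → ℂ)} (hL : ForcedInHull.{u} a L) : L ⊆ monomialSet a := by
  intro s hs
  rw [monomialSet_eq_boundedSet ha0 hmul]
  rintro _ ⟨i, hi, rfl⟩
  have hfin := ratioSup_lt_top ha0 hmul hi
  have hzero : intExp (0 : Fin n → ℕ) = 0 := rfl
  obtain ⟨A, _, _, _, x, hx, hne, hσ⟩ := exists_admissible_algebra.{u} (a := a)
    (fun m => sInf (extensionNorms a i m))
    (by rw [← hzero, sInf_extensionNorms_intExp hfin, ha0])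
    (fun m hm m' hm' => sInf_extensionNorms_add_le hmul i hm hm')
  obtain ⟨E, hE, hLE⟩ := hL A x fun m => by rw [hx, sInf_extensionNorms_intExp hfin]
  have hsub : jointSpectrum x ⊆ boundedSet (singleBounds a i) := by
    rintro t ht p (⟨k, rfl⟩ | ⟨k, hk, rfl⟩ | rfl)
    · refine (hσ t ht _ (single_mem_admissibleExps k)).imp_right fun h => h.trans (le_of_eq ?_)
      have : intExp (Pi.single k 1 : Fin n → ℕ) = Pi.single k 1 := by
        funext l
        by_cases hl : l = k
        · subst hl; simp
        · simp [Pi.single_eq_of_ne hl]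
      rw [← this, sInf_extensionNorms_intExp hfin]
    · exact (hσ t ht _ (neg_single_mem_admissibleExps hk)).imp_right fun h => h.trans
        (NNReal.coe_le_coe.2 (sInf_extensionNorms_neg_single_le ha0 i hk))
    · exact (hσ t ht _ hi).imp_right fun h => h.trans
        (NNReal.coe_le_coe.2 (sInf_extensionNorms_self_le ha0 i))
  have hcpt : IsCompact (boundedSet (singleBounds a i)) := by
    refine isCompact_boundedSet (fun k => ⟨_, Or.inl ⟨k, rfl⟩⟩) ?_
    have hk : ∀ k ∈ finiteDirs a, ∃ B, (-Pi.single k 1, B) ∈ singleBounds a i :=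
      fun k hk => ⟨_, Or.inr (Or.inl ⟨k, hk, rfl⟩)⟩
    rintro p (⟨l, rfl⟩ | ⟨l, hl, rfl⟩ | rfl) k hpk
    · exact hk k (mem_finiteDirs_of_neg (single_mem_admissibleExps l) hpk)
    · exact hk k (mem_finiteDirs_of_neg (neg_single_mem_admissibleExps hl) hpk)
    · exact hk k (mem_finiteDirs_of_neg hi hpk)
  exact hE.2 ⟨isRCC_boundedSet (hne.mono hsub) hcpt, hsub⟩ (hLE hs) _ (Or.inr (Or.inr rfl))

end MonomialSet

/-! ### K lies in the hull of the joint spectrum -/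

section Forced

lemma prod_pow_add {n : ℕ} {A : Type*} [CommMonoid A] (x : Fin n → A) (m m' : Fin n → ℕ) :
    ∏ k, x k ^ (m + m') k = (∏ k, x k ^ m k) * ∏ k, x k ^ m' k := by
  simp [pow_add, Finset.prod_mul_distrib]

variable {n : ℕ} {a : (Fin n → ℕ) → ℝ≥0} {A : Type*} [NormedCommRing A] {x : Fin n → A}

/-- Here y plays the role of x^i: cancelling the unit gives x^{m'} = y x^m whenever m' = m + i. -/
lemma ratioSup_le_norm (hx : ∀ i : Fin n → ℕ, ‖∏ k, x k ^ i k‖ = a i) {i : Fin n → ℤ}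
    (hne : (shiftPairs a i).Nonempty) {y : A}
    (hu : IsUnit (∏ k, x k ^ negPart i k))
    (hy : y * ∏ k, x k ^ negPart i k = ∏ k, x k ^ posPart i k) : ratioSup a i ≤ ‖y‖₊ := by
  refine ratioSup_le hne fun m m' h => ?_
  have h1 : m' + negPart i = posPart i + m := by
    funext k
    have h2 := congrFun h k
    have h3 := congrFun (intExp_posPart i) k
    simp only [intExp, Pi.add_apply] at h2 h3 ⊢
    omega
  have h2 : ∏ k, x k ^ m' k = y * ∏ k, x k ^ m k := by
    rw [← hu.mul_left_inj, ← prod_pow_add, h1, prod_pow_add, ← hy]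
    ring
  rw [← NNReal.coe_le_coe, NNReal.coe_mul, ← hx, ← hx, h2, coe_nnnorm]
  exact norm_mul_le _ _

lemma mem_finiteDirs_of_isUnit (ha0 : a 0 = 1) (hx : ∀ i : Fin n → ℕ, ‖∏ k, x k ^ i k‖ = a i)
    {k : Fin n} (hk : IsUnit (x k)) : k ∈ finiteDirs a := by
  have hneg : negPart (-Pi.single k 1 : Fin n → ℤ) = Pi.single k 1 := by
    funext l
    by_cases hl : l = k
    · subst hl; simp [negPart]
    · simp [negPart, Pi.single_eq_of_ne hl]
  have hpos : posPart (-Pi.single k 1 : Fin n → ℤ) = 0 := by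
    funext l
    by_cases hl : l = k
    · subst hl; simp [posPart]
    · simp [posPart, Pi.single_eq_of_ne hl]
  have hprod : ∏ l, x l ^ (Pi.single k 1 : Fin n → ℕ) l = x k := by
    rw [Finset.prod_eq_single k]
    · simp
    · intro l _ hl
      simp [Pi.single_eq_of_ne hl]
    · simp
  obtain ⟨y, hy⟩ := hk.exists_left_inv
  refine lt_of_le_of_lt (ratioSup_le_norm hx (y := y) ?_ ?_ ?_) ENNReal.coe_lt_top
  · refine ⟨(Pi.single k 1, 0), fun l => ?_, fun h => ?_⟩
    · by_cases hl : l = k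
      · subst hl; simp
      · simp [Pi.single_eq_of_ne hl]
    · rw [ha0] at h
      exact one_ne_zero h.2
  · rwa [hneg, hprod]
  · rw [hneg, hpos, hprod, hy]
    simp

variable [NormedAlgebra ℂ A] [CompleteSpace A]

lemma exists_least_isRCC (h1 : ‖(1 : A)‖ = 1) (x : Fin n → A) :
    IsLeast {E' : Set (Fin n → ℂ) | IsRCC E' ∧ jointSpectrum x ⊆ E'}
      (⋂₀ {E' : Set (Fin n → ℂ) | IsRCC E' ∧ jointSpectrum x ⊆ E'}) := by
  have hne : (jointSpectrum x).Nonempty := by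
    have : Nontrivial A := ⟨⟨0, 1, fun h => by
      rw [← h, norm_zero] at h1
      exact zero_ne_one h1⟩⟩
    obtain ⟨φ, -⟩ := exists_character_eq_zero (not_isUnit_zero (M₀ := A))
    exact ⟨_, φ, rfl⟩
  have hsub : jointSpectrum x ⊆ ⋂₀ {E' : Set (Fin n → ℂ) | IsRCC E' ∧ jointSpectrum x ⊆ E'} :=
    Set.subset_sInter fun E hE => hE.2
  refine ⟨⟨isRCC_sInter ?_ (fun E hE => hE.1) (hne.mono hsub), hsub⟩,
    fun E hE => Set.sInter_subset_of_mem hE⟩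
  -- The polydisc with radii ‖x k‖ shows that the family to be intersected is nonempty.
  let F : Set ((Fin n → ℤ) × ℝ) := Set.range fun k => (Pi.single k 1, ‖x k‖)
  have hF : jointSpectrum x ⊆ boundedSet F := by
    rintro _ ⟨φ, rfl⟩ _ ⟨k, rfl⟩
    refine ⟨fun l hl => absurd hl (not_lt.2 ?_), ?_⟩
    · exact (Pi.single_nonneg.2 zero_le_one : (0 : Fin n → ℤ) ≤ Pi.single k 1) l
    · simp only [prod_zpow_single, zpow_one]
      exact norm_character_le h1 φ _
  refine ⟨boundedSet F, isRCC_boundedSet (hne.mono hF) (isCompact_boundedSet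
    (fun k => ⟨_, k, rfl⟩) ?_), hF⟩
  rintro _ ⟨k, rfl⟩ l hl
  exact absurd hl (not_lt.2
    ((Pi.single_nonneg.2 zero_le_one : (0 : Fin n → ℤ) ≤ Pi.single k 1) l))

/-- By the spectral radius formula, the N-th roots of ‖y ^ N‖ tend to the largest modulus of a
character value at y. -/
lemma norm_le_of_norm_pow_le {z : ℂ} {y : A} {B : ℝ} (hB : ∀ φ : A →ₐ[ℂ] ℂ, ‖φ y‖ ≤ B)
    (hB0 : 0 ≤ B) (hz : ∀ N : ℕ, ‖z ^ N‖ ≤ ‖y ^ N‖) : ‖z‖ ≤ B := by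
  have hrad : spectralRadius ℂ y ≤ ENNReal.ofReal B := by
    refine iSup₂_le fun w hw => ?_
    obtain ⟨φ, rfl⟩ := WeakDual.CharacterSpace.mem_spectrum_iff_exists.1 hw
    change ‖φ y‖ₑ ≤ _
    rw [← ofReal_norm]
    exact ENNReal.ofReal_le_ofReal (hB (WeakDual.CharacterSpace.toAlgHom φ))
  have hlim := spectrum.pow_nnnorm_pow_one_div_tendsto_nhds_spectralRadius y
  have hle : ‖z‖ₑ ≤ spectralRadius ℂ y := by
    refine ge_of_tendsto hlim ?_
    filter_upwards [Filter.eventually_ge_atTop 1] with N hN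
    have h1 : ‖z‖ₑ ^ N ≤ (‖y ^ N‖₊ : ℝ≥0∞) := by
      rw [← enorm_pow]
      exact ENNReal.coe_le_coe.2 (hz N)
    calc ‖z‖ₑ = (‖z‖ₑ ^ N) ^ (1 / N : ℝ) := by
          rw [one_div, ENNReal.pow_rpow_inv_natCast (by omega)]
      _ ≤ _ := ENNReal.rpow_le_rpow h1 (by positivity)
  have := hle.trans hrad
  rwa [← ofReal_norm, ENNReal.ofReal_le_ofReal_iff hB0] at this

lemma toNat_natCast_mul (N : ℕ) (z : ℤ) : (N * z).toNat = N * z.toNat := by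
  rcases le_total 0 z with h | h
  · lift z to ℕ using h
    rw [← Nat.cast_mul, Int.toNat_natCast, Int.toNat_natCast]
  · rw [Int.toNat_of_nonpos h,
      Int.toNat_of_nonpos (mul_nonpos_of_nonneg_of_nonpos (Int.natCast_nonneg N) h), mul_zero]

/-- It suffices to check the monomial bounds of E. A coordinate with negative exponent is nonzero on
the spectrum, so x k is invertible and k ∈ S; thus C_i is among the bounds defining K. -/
theorem monomialSet_subset_of_isRCC (ha0 : a 0 = 1)
    (hx : ∀ i : Fin n → ℕ, ‖∏ k, x k ^ i k‖ = a i) {E : Set (Fin n → ℂ)} (hE : IsRCC E)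
    (hσ : jointSpectrum x ⊆ E) : monomialSet a ⊆ E := by
  intro s hs
  rw [hE.eq_boundedSet]
  rintro ⟨i, B⟩ ⟨hdef, hB⟩
  have hunit : ∀ k, i k < 0 → IsUnit (x k) := fun k hk => by
    by_contra h
    obtain ⟨φ, hφ⟩ := exists_character_eq_zero h
    exact hdef k hk _ (hσ ⟨φ, rfl⟩) hφ
  have hadm : i ∈ admissibleExps a := fun k hk => by
    by_contra! h
    exact hk (mem_finiteDirs_of_isUnit ha0 hx (hunit k h))
  refine ⟨(hs i hadm).1, ?_⟩
  have hu : IsUnit (∏ k, x k ^ negPart i k) := by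
    refine IsUnit.prod_univ_iff.2 fun k => ?_
    rcases lt_or_ge (i k) 0 with h | h
    · exact (hunit k h).pow _
    · rw [negPart, Int.toNat_of_nonpos (by omega), pow_zero]
      exact isUnit_one
  obtain ⟨v, hv⟩ := hu.exists_left_inv
  set y := (∏ k, x k ^ posPart i k) * v with hy
  have hyx : y * ∏ k, x k ^ negPart i k = ∏ k, x k ^ posPart i k := by
    rw [hy, mul_assoc, hv, mul_one]
  obtain ⟨z, hz⟩ := hE.2.1.nonempty
  refine norm_le_of_norm_pow_le (y := y) (fun φ => ?_)
    ((norm_nonneg _).trans (hB z hz)) fun N => ?_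
  · have h1 := congrArg φ hyx
    simp only [map_mul, map_prod, map_pow] at h1
    have h2 := hB _ (hσ ⟨φ, rfl⟩)
    have h3 := eval_monomialNum_neg_ne_zero (i := i) fun k hk => hdef k hk _ (hσ ⟨φ, rfl⟩)
    simp only at h2
    rw [← eval_monomialNum_div] at h2
    rw [eval_monomialNum] at h3
    rw [eval_monomialNum, eval_monomialNum] at h2
    refine le_of_eq_of_le ?_ h2
    rw [eq_div_of_mul_eq h3 h1]
    rfl
  -- The bound C_i alone only gives ‖y‖; using C_{Ni} for all N replaces the norm by the spectral
  -- radius.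
  · have hadmN : N • i ∈ admissibleExps a := (admissibleMonoid a).nsmul_mem hadm N
    have hneg : negPart (N • i) = N • negPart i := by
      funext k
      simp only [negPart, Pi.smul_apply, smul_eq_mul, nsmul_eq_mul]
      rw [← mul_neg, toNat_natCast_mul]
    have hpos : posPart (N • i) = N • posPart i := by
      funext k
      simp only [posPart, Pi.smul_apply, smul_eq_mul, nsmul_eq_mul]
      rw [toNat_natCast_mul]
    have hpow : ∀ m : Fin n → ℕ, ∏ k, x k ^ (N • m) k = (∏ k, x k ^ m k) ^ N := fun m => by
      rw [← Finset.prod_pow]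
      exact Finset.prod_congr rfl fun k _ => by
        rw [Pi.smul_apply, smul_eq_mul, mul_comm, pow_mul]
    have h1 := ratioSup_le_norm hx (shiftPairs_nonempty ha0 hadmN) (y := y ^ N)
      (by rw [hneg, hpow]; exact hu.pow N)
      (by rw [hneg, hpos, hpow, hpow, ← mul_pow, hyx])
    have h2 := ((hs _ hadmN).2.trans h1 : ‖∏ k, s k ^ (N • i) k‖ₑ ≤ _)
    have h3 : ∏ k, s k ^ (N • i) k = (∏ k, s k ^ i k) ^ N := by
      rw [← Finset.prod_pow]
      exact Finset.prod_congr rfl fun k _ => by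
        rw [Pi.smul_apply, nsmul_eq_mul, mul_comm, zpow_mul, zpow_natCast]
    rw [h3] at h2
    exact ENNReal.coe_le_coe.1 h2

theorem forcedInHull_monomialSet (ha0 : a 0 = 1) : ForcedInHull.{u} a (monomialSet a) := by
  intro A _ _ _ x hx
  have h1 : ‖(1 : A)‖ = 1 := by
    have := hx 0
    simpa [ha0] using this
  exact ⟨_, exists_least_isRCC h1 x,
    Set.subset_sInter fun E hE => monomialSet_subset_of_isRCC ha0 hx hE.1 hE.2⟩

end Forced

end JointSpec

theorem theorem4p13 (n : ℕ) (a : (Fin n → ℕ) → ℝ≥0) (ha0 : a 0 = 1)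
    (hmul : ∀ i j, a (i + j) ≤ a i * a j) :
    JointSpec.IsRCC (JointSpec.monomialSet a) ∧
    JointSpec.ForcedInHull.{u} a (JointSpec.monomialSet a) ∧
    ∀ L : Set (Fin n → ℂ), JointSpec.ForcedInHull.{u} a L → L ⊆ JointSpec.monomialSet a :=
  ⟨JointSpec.isRCC_monomialSet ha0 hmul, JointSpec.forcedInHull_monomialSet ha0,
    fun _ hL => JointSpec.subset_monomialSet ha0 hmul hL⟩
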